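/- A closed polygonal line in a set $N\subset\mathbb R^2$ is a nonempty finite sequence of points, not necessarily distinct, considered up to cyclic shift, such that for any two cyclically consecutive points $A,B$ the segment $AB$ is contained in $N$. An elementary cancellation in $N$ of a closed polygonal line in $N$ is the removal of one of its vertices $B$ (not the only one) such that, for the vertices $A,C$ (not necessarily distinct) adjacent to $B$, the convex hull of $A,B,C$ is contained in $N$. Two closed polygonal lines in $N$ are homotopic in $N$ if there is a finite sequence of closed polygonal lines in $N$ from the first one to the second one such that for any two consecutive members of the sequence, one is obtained from the other by an elementary cancellation in $N$. **Theorem 1.7.** For every integer $n\ge 0$ there is an algorithm that, given $n$ distinct points $P_1,\dots,P_n$ of the plane and two closed polygonal lines in $N=\mathbb R^2\setminus\{P_1,\dots,P_n\}$, decides whether the two lines are homotopic in $N$. Precisely: (1) There is a Turing computable function that, given $n$ distinct points with rational coordinates and two such lines whose vertices have rational coordinates (points being given by the numerators and denominators of their coordinates), returns "yes" if the two lines are homotopic in $N$, and "no" otherwise. (2) For arbitrary points and lines there is an algorithm with exact real arithmetic: a computable procedure that knows the numbers of vertices of the two lines, and has access to the coordinates of $P_1,\dots,P_n$ and of the vertices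 only by asking, for polynomials $p$ with integer coefficients chosen by it step by step, whether $p>0$ at these coordinates; on every input it stops after finitely many steps and correctly returns whether the two lines are homotopic in $N$. -/

import Mathlib

/-- The plane. Only its real affine structure matters here (segments and convex hulls). -/
abbrev Plane : Type := ℝ × ℝ

/-- The plane minus the points `P 0, …, P (n - 1)`. -/
def planeMinus {n : ℕ} (P : Fin n → Plane) : Set Plane := (Set.range P)ᶜ

/-- A closed (oriented) polygonal line in `N`: a nonempty oriented cyclic sequence of points of the
plane, not necessarily distinct, such that for any two cyclically consecutive points `A`, `B` the
segment `AB` is contained in `N`. A one-point line `A` has the single degenerate segment `AA`. -/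
def IsClosedPolygonalLine (N : Set Plane) (c : Cycle Plane) : Prop :=
  c ≠ Cycle.nil ∧ c.Chain (fun A B => segment ℝ A B ⊆ N)

/-- The closed polygonal lines in `N`. -/
def ClosedPolygonalLine (N : Set Plane) : Type :=
  {c : Cycle Plane // IsClosedPolygonalLine N c}

/-- `d` is obtained from `c` by an elementary cancellation in `N`: one vertex `B` of `c` is removed,
where the convex hull of `A`, `B`, `C` is contained in `N` for the vertices `A`, `C` adjacent
to `B` (possibly `A = C`, for instance when `c` has just two vertices). Here `c` is read cyclically
from `B`, so that `A` is the last and `C` the first one of the remaining vertices. -/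
def ElementaryCancellation (N : Set Plane) (c d : ClosedPolygonalLine N) : Prop :=
  ∃ (B : Plane) (l : List Plane) (hl : l ≠ []),
    c.1 = ((B :: l : List Plane) : Cycle Plane) ∧ d.1 = (l : Cycle Plane) ∧
      convexHull ℝ {l.getLast hl, B, l.head hl} ⊆ N

/-- Piecewise linear homotopy in `N`: there is a finite sequence of closed polygonal lines in `N`
from `c` to `d` such that for any two consecutive ones, one is obtained from the other by an
elementary cancellation in `N`. -/
def Homotopic (N : Set Plane) (c d : ClosedPolygonalLine N) : Prop :=
  Relation.ReflTransGen
    (fun a b => ElementaryCancellation N a b ∨ ElementaryCancellation N b a) c d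

/-- Finite description of a point with rational coordinates: the pair `(p, q)` describes the
rational number `p / (q + 1)`. -/
abbrev RatPoint : Type := (ℤ × ℕ) × (ℤ × ℕ)

/-- The point of the plane with the given finite description. -/
noncomputable def RatPoint.toPlane (a : RatPoint) : Plane :=
  ((a.1.1 : ℝ) / ((a.1.2 : ℝ) + 1), (a.2.1 : ℝ) / ((a.2.2 : ℝ) + 1))

/-- A polynomial with integer coefficients in variables `X 0, X 1, …`, written as a list of terms:
`(a, [i, j, …])` stands for `a * X i * X j * …`. -/
abbrev IntPoly : Type := List (ℤ × List ℕ)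

/-- The value of a polynomial at a finite sequence `x` of real numbers; variables beyond the end
of `x` take the value `0`. -/
noncomputable def IntPoly.eval (x : List ℝ) (p : IntPoly) : ℝ :=
  (p.map (fun t => (t.1 : ℝ) * (t.2.map (fun i => x.getD i 0)).prod)).sum

/-- The possible histories of a run on the real input `x`. At each moment the control `S` looks at
the list of the answers received so far (latest answer first). Either it asks whether
`p (x) > 0` for an integer polynomial `p` of its choice, and receives the correct answer, or it
stops and returns a Boolean value. -/
inductive ReachesHistory (S : List Bool → IntPoly ⊕ Bool) (x : List ℝ) : List Bool → Prop
  | start : ReachesHistory S x []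
  | yes {h : List Bool} {p : IntPoly} : ReachesHistory S x h → S h = Sum.inl p →
      0 < p.eval x → ReachesHistory S x (true :: h)
  | no {h : List Bool} {p : IntPoly} : ReachesHistory S x h → S h = Sum.inl p →
      ¬ 0 < p.eval x → ReachesHistory S x (false :: h)

/-- The run on the real input `x` stops after finitely many steps and returns `b`. -/
def HaltsWith (S : List Bool → IntPoly ⊕ Bool) (x : List ℝ) (b : Bool) : Prop :=
  ∃ h : List Bool, ReachesHistory S x h ∧ S h = Sum.inr b

/-- The finite sequence of the coordinates of a finite sequence of points. -/
def coords (l : List Plane) : List ℝ := l.flatMap (fun A => [A.1, A.2])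

/-- An algorithm, in the sense of Turing machines, that recognizes homotopy of closed polygonal
lines in the plane minus `n` points for points and lines with rational coordinates. Its input
consists of the `n` distinct points and of the vertices of the two lines, listed from an arbitrary
vertex. -/
def DecidesRationalHomotopy (n : ℕ)
    (D : (Fin n → RatPoint) × List RatPoint × List RatPoint → Bool) : Prop :=
  Computable D ∧
    ∀ (P : Fin n → RatPoint) (l m : List RatPoint),
      Function.Injective (fun i => (P i).toPlane) →
      ∀ (hl : IsClosedPolygonalLine (planeMinus fun i => (P i).toPlane)
            (l.map RatPoint.toPlane : List Plane))
        (hm : IsClosedPolygonalLine (planeMinus fun i => (P i).toPlane)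
            (m.map RatPoint.toPlane : List Plane)),
        D (P, l, m) = true ↔
          Homotopic (planeMinus fun i => (P i).toPlane) ⟨_, hl⟩ ⟨_, hm⟩

/-- An algorithm with exact real arithmetic that recognizes homotopy of closed polygonal lines in
the plane minus `n` points for arbitrary points and lines. The control `S` is one computable
function. It knows the numbers of vertices of the two lines, and has access to the real coordinates
of the `n` points and of the vertices through exact tests `p > 0` for integer polynomials `p`
in these coordinates. It stops on every input. -/
def DecidesRealHomotopy (n : ℕ)
    (S : (ℕ × ℕ) × List Bool → IntPoly ⊕ Bool) : Prop :=
  Computable S ∧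
    ∀ (P : Fin n → Plane) (l m : List Plane), Function.Injective P →
      ∀ (hl : IsClosedPolygonalLine (planeMinus P) l)
        (hm : IsClosedPolygonalLine (planeMinus P) m),
        ∃ b : Bool,
          HaltsWith (fun h => S ((l.length, m.length), h)) (coords (List.ofFn P ++ l ++ m)) b ∧
            (b = true ↔ Homotopic (planeMinus P) ⟨_, hl⟩ ⟨_, hm⟩)

/-! Draw an upward ray from each `P i` and record the signed crossings of a closed line with these
rays. This gives a word in the free group on the points. Ties are settled by the lexicographic
order, which amounts to tilting the vertical direction infinitesimally. Homotopy classes of closed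
lines then correspond to conjugacy classes of words (`homotopic_iff_isConj`).

Invariance: in a triangle that contains no `P i`, the words of two consecutive sides multiply to the
word of the third (`edgeWord_mul`). An elementary cancellation therefore changes the word of a
closed line only by conjugation (`isConj_of_homotopic`).

Converse: finite sequences of points, modulo replacement inside closed lines, form a monoid
(`lineCon`), where a vertex may be dropped across an empty triangle. In general position, joining
the ends of an edge to a base point far below turns the edge into a loop. The class of this loop is
the image of the crossing word under a multiplicative map from the free group
(`exists_map_edgeWord`): cut the edge into pieces with at most one point in the vertical strip of
each; a piece below its point contracts, and a piece above it can be pushed up to a standard loop.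
So the class of a closed line depends only on its word, and conjugating the word amounts to
rereading the line from another vertex. A small shear produces general position without changing any
word.

Decidability: words are conjugate in a free group exactly when some of their rotations have the same
reduced form (`FreeGroup.isConj_mk_iff`). The word of an edge is determined by finitely many signs
of coordinate differences and areas (`configLetters_factorsThrough`), hence is found in a finite
table. These signs are computable for fractions and are polynomial queries for real data. -/

/-! ### Lexicographic order and points in triangles. -/

/-- Twice the oriented area of the triangle `ABC`. -/
def area (A B C : Plane) : ℝ := (B.1 - A.1) * (C.2 - A.2) - (B.2 - A.2) * (C.1 - A.1)

/-- The point `A` strictly precedes `B` in the lexicographic order of the plane. -/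
def LexLt (A B : Plane) : Prop := toLex A < toLex B

theorem lexLt_iff {A B : Plane} : LexLt A B ↔ A.1 < B.1 ∨ (A.1 = B.1 ∧ A.2 < B.2) := by
  simp [LexLt, Prod.Lex.lt_iff]

theorem LexLt.trans {A B C : Plane} (h : LexLt A B) (h' : LexLt B C) : LexLt A C :=
  lt_trans (a := toLex A) h h'

theorem LexLt.asymm {A B : Plane} (h : LexLt A B) : ¬ LexLt B A :=
  lt_asymm (a := toLex A) h

theorem LexLt.irrefl (A : Plane) : ¬ LexLt A A := lt_irrefl (toLex A)

theorem lexLt_trichotomy (A B : Plane) : LexLt A B ∨ A = B ∨ LexLt B A := by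
  rcases lt_trichotomy (toLex A) (toLex B) with h | h | h
  · exact Or.inl h
  · exact Or.inr (Or.inl (toLex.injective h))
  · exact Or.inr (Or.inr h)

theorem lexLt_of_not_of_lt {A B C : Plane} (h : ¬ LexLt B A) (h' : LexLt B C) : LexLt A C :=
  lt_of_le_of_lt (not_lt.1 h : toLex A ≤ toLex B) h'

theorem lexLt_of_lt_of_not {A B C : Plane} (h : LexLt A B) (h' : ¬ LexLt C B) : LexLt A C :=
  lt_of_lt_of_le h (not_lt.1 h' : toLex B ≤ toLex C)

/-- On finitely many points, the lexicographic order is the order of the values of a suitable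
linear functional `x + ε y`. -/
theorem exists_functional (s : Finset Plane) :
    ∃ ε : ℝ, 0 < ε ∧ ∀ A ∈ s, ∀ B ∈ s, LexLt A B ↔ A.1 + ε * A.2 < B.1 + ε * B.2 := by
  -- For a single pair every small positive `ε` works: a strict inequality of first coordinates
  -- survives a small perturbation, and a tie is broken by the second coordinates.
  have key : ∀ A B : Plane, LexLt A B →
      ∀ᶠ ε : ℝ in nhdsWithin 0 (Set.Ioi 0), A.1 + ε * A.2 < B.1 + ε * B.2 := by
    intro A B h
    rcases lexLt_iff.1 h with h | ⟨h, h'⟩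
    · have c1 : Filter.Tendsto (fun ε : ℝ => A.1 + ε * A.2) (nhdsWithin 0 (Set.Ioi 0))
          (nhds (A.1 + 0 * A.2)) :=
        (Continuous.tendsto (by fun_prop) (0 : ℝ)).mono_left nhdsWithin_le_nhds
      have c2 : Filter.Tendsto (fun ε : ℝ => B.1 + ε * B.2) (nhdsWithin 0 (Set.Ioi 0))
          (nhds (B.1 + 0 * B.2)) :=
        (Continuous.tendsto (by fun_prop) (0 : ℝ)).mono_left nhdsWithin_le_nhds
      exact c1.eventually_lt c2 (by simpa using h)
    · filter_upwards [self_mem_nhdsWithin] with ε hε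
      have : ε * A.2 < ε * B.2 := mul_lt_mul_of_pos_left h' hε
      linarith
  have all : ∀ᶠ ε : ℝ in nhdsWithin 0 (Set.Ioi 0), ∀ A ∈ s, ∀ B ∈ s,
      LexLt A B → A.1 + ε * A.2 < B.1 + ε * B.2 := by
    rw [Filter.eventually_all_finset]
    intro A _
    rw [Filter.eventually_all_finset]
    intro B _
    by_cases h : LexLt A B
    · filter_upwards [key A B h] with ε hε _ using hε
    · exact Filter.Eventually.of_forall fun _ h' => absurd h' h
  obtain ⟨ε, hε, h0⟩ := (all.and self_mem_nhdsWithin).exists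
  refine ⟨ε, h0, fun A hA B hB => ⟨hε A hA B hB, fun h => ?_⟩⟩
  rcases lexLt_trichotomy A B with h' | h' | h'
  · exact h'
  · subst h'; exact absurd h (lt_irrefl _)
  · exact absurd h (lt_asymm (hε B hB A hA h'))

theorem mem_convexHull_triple {A B C X : Plane} {a b c : ℝ} (ha : 0 ≤ a) (hb : 0 ≤ b)
    (hc : 0 ≤ c) (h : a + b + c = 1) (h1 : X.1 = a * A.1 + b * B.1 + c * C.1)
    (h2 : X.2 = a * A.2 + b * B.2 + c * C.2) : X ∈ convexHull ℝ {A, B, C} := by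
  have hX : X = ∑ i : Fin 3, (![a, b, c] i) • (![A, B, C] i) := by
    rw [Fin.sum_univ_three]
    ext <;> simp [h1, h2]
  rw [hX]
  refine (convex_convexHull ℝ _).sum_mem ?_ (by simp [Fin.sum_univ_three, h]) ?_
  · intro i _; fin_cases i <;> simpa
  · intro i _; apply subset_convexHull; fin_cases i <;> simp

/-- The sign condition puts `X` in the angle at `A` spanned by `B` and `C`; the linear functional
bounds its distance from `A`. Degenerate triangles are allowed. -/
theorem mem_convexHull_of_area {A B C X : Plane} {p q : ℝ}
    (h1 : p * A.1 + q * A.2 < p * X.1 + q * X.2) (h2 : p * X.1 + q * X.2 < p * B.1 + q * B.2)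
    (h3 : p * B.1 + q * B.2 ≤ p * C.1 + q * C.2) (h : area A B X * area A C X ≤ 0) :
    X ∈ convexHull ℝ {A, B, C} := by
  -- By Cramer's rule `d (X - A) = α (B - A) + β (C - A)`; `u`, `v`, `w` are the increments of the
  -- functional from `A` to `B`, `C`, `X`.
  obtain ⟨α, hα⟩ : ∃ α, α = - area A C X := ⟨_, rfl⟩
  obtain ⟨β, hβ⟩ : ∃ β, β = area A B X := ⟨_, rfl⟩
  obtain ⟨d, hd⟩ : ∃ d, d = area A B C := ⟨_, rfl⟩
  obtain ⟨u, hu⟩ : ∃ u, u = p * (B.1 - A.1) + q * (B.2 - A.2) := ⟨_, rfl⟩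
  obtain ⟨v, hv⟩ : ∃ v, v = p * (C.1 - A.1) + q * (C.2 - A.2) := ⟨_, rfl⟩
  obtain ⟨w, hw⟩ : ∃ w, w = p * (X.1 - A.1) + q * (X.2 - A.2) := ⟨_, rfl⟩
  have hw0 : 0 < w := by rw [hw]; linarith
  have hwu : w < u := by rw [hw, hu]; linarith
  have huv : u ≤ v := by rw [hu, hv]; linarith
  have hs : 0 ≤ α * β := by rw [hα, hβ]; linarith
  have e1 : d * (X.1 - A.1) = α * (B.1 - A.1) + β * (C.1 - A.1) := by
    rw [hα, hβ, hd]; unfold area; ring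
  have e2 : d * (X.2 - A.2) = α * (B.2 - A.2) + β * (C.2 - A.2) := by
    rw [hα, hβ, hd]; unfold area; ring
  have e3 : d * w = α * u + β * v := by
    rw [hw, hu, hv]; linear_combination p * e1 + q * e2
  have hu0 : 0 < u := by linarith
  have hv0 : 0 < v := by linarith
  by_cases hd0 : d = 0
  -- Collinear case: `α u + β v = 0` with `α β ≥ 0` and positive `u`, `v` forces `β = 0`, so `X`
  -- lies on `AB` at the ratio `w / u`.
  · have hαβ : β = 0 := by
      rw [hd0, zero_mul] at e3
      have : β * (α * u + β * v) = 0 := by rw [← e3, mul_zero]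
      have h4 : 0 ≤ α * β * u := mul_nonneg hs hu0.le
      have h5 : β * β * v = 0 := le_antisymm (by nlinarith) (mul_nonneg (mul_self_nonneg β) hv0.le)
      have h6 : β * β = 0 := by
        rcases mul_eq_zero.1 h5 with h | h
        · exact h
        · exact absurd h hv0.ne'
      exact mul_self_eq_zero.1 h6
    have g1 : (B.1 - A.1) * w = (X.1 - A.1) * u := by
      rw [hαβ] at hβ; unfold area at hβ; rw [hw, hu]; linear_combination -q * hβ
    have g2 : (B.2 - A.2) * w = (X.2 - A.2) * u := by
      rw [hαβ] at hβ; unfold area at hβ; rw [hw, hu]; linear_combination p * hβ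
    refine mem_convexHull_triple (a := 1 - w / u) (b := w / u) (c := 0) ?_ (by positivity) le_rfl
      (by ring) ?_ ?_
    · rw [sub_nonneg, div_le_one hu0]; exact hwu.le
    · field_simp; linear_combination -g1
    · field_simp; linear_combination -g2
  · have hst : ∀ γ : ℝ, 0 ≤ γ * α → 0 ≤ γ * β → 0 ≤ γ * d := by
      intro γ h4 h5
      have : 0 ≤ (γ * d) * w := by
        have : (γ * d) * w = (γ * α) * u + (γ * β) * v := by linear_combination γ * e3
        rw [this]; positivity
      exact nonneg_of_mul_nonneg_left this hw0
    have hdd : 0 < d * d := mul_self_pos.2 hd0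
    have hda : 0 ≤ d * α ∧ 0 ≤ d * β := by
      rcases lt_trichotomy α 0 with h4 | h4 | h4
      · have h5 : β ≤ 0 := by nlinarith
        have h6 : 0 ≤ (-1) * d := hst (-1) (by linarith) (by linarith)
        constructor <;> nlinarith
      · rw [h4, mul_zero]
        have := hst β (by rw [h4]; simp) (mul_self_nonneg _)
        exact ⟨le_rfl, by linarith⟩
      · have h5 : 0 ≤ β := by nlinarith
        have h6 : 0 ≤ 1 * d := hst 1 (by linarith) (by linarith)
        constructor <;> nlinarith
    have hs0 : 0 ≤ α / d := by
      have : α / d = d * α / (d * d) := by field_simp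
      rw [this]; exact div_nonneg hda.1 hdd.le
    have ht0 : 0 ≤ β / d := by
      have : β / d = d * β / (d * d) := by field_simp
      rw [this]; exact div_nonneg hda.2 hdd.le
    have hw' : w = α / d * u + β / d * v := by field_simp; linarith
    -- A coefficient sum above `1` would give `w > u`, because `u ≤ v`.
    have hle : α / d + β / d ≤ 1 := by
      by_contra hcon
      push Not at hcon
      nlinarith
    refine mem_convexHull_triple (a := 1 - α / d - β / d) (b := α / d) (c := β / d) (by linarith)
      hs0 ht0 (by ring) ?_ ?_
    · field_simp; linarith
    · field_simp; linarith

/-! ### Crossing words of segments. -/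

/-- The segment from `A` to `B` crosses the upward ray from `X` from left to right. -/
def Crosses (X A B : Plane) : Prop := LexLt A X ∧ LexLt X B ∧ area A B X < 0

/-- If exactly one of `AB`, `AC` passed above `X`, or one of them passed through it, then `X` would
lie in the triangle. So both areas have the same strict sign. -/
theorem crosses_iff_left {A B C X : Plane} (hBC : ¬ LexLt C B)
    (hX : X ∉ convexHull ℝ {A, B, C}) (hXB : LexLt X B) :
    Crosses X A C ↔ Crosses X A B := by
  have hXC : LexLt X C := lexLt_of_lt_of_not hXB hBC
  unfold Crosses
  by_cases hAX : LexLt A X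
  · simp only [hAX, hXB, hXC, true_and]
    obtain ⟨ε, -, hε⟩ := exists_functional {A, B, C, X}
    have : ¬ area A B X * area A C X ≤ 0 := fun h => hX <| by
      refine mem_convexHull_of_area (p := 1) (q := ε) ?_ ?_ ?_ h
      · simpa using (hε A (by simp) X (by simp)).1 hAX
      · simpa using (hε X (by simp) B (by simp)).1 hXB
      · simpa using not_lt.1 ((hε C (by simp) B (by simp)).not.1 hBC)
    constructor <;> intro h <;> nlinarith
  · simp [hAX]

/-- The mirror image of `crosses_iff_left`: the functional changes sign, and `A` and `C` exchange
roles. -/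
theorem crosses_iff_right {A B C X : Plane} (hAB : ¬ LexLt B A)
    (hX : X ∉ convexHull ℝ {A, B, C}) (hBX : LexLt B X) :
    Crosses X A C ↔ Crosses X B C := by
  have hAX : LexLt A X := lexLt_of_not_of_lt hAB hBX
  unfold Crosses
  by_cases hXC : LexLt X C
  · simp only [hAX, hBX, hXC, true_and]
    obtain ⟨ε, -, hε⟩ := exists_functional {A, B, C, X}
    have e1 : area A C X = - area C A X := by unfold area; ring
    have e2 : area B C X = - area C B X := by unfold area; ring
    have : ¬ area C B X * area C A X ≤ 0 := fun h => hX <| by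
      have hset : ({A, B, C} : Set Plane) = {C, B, A} := by
        ext x; simp only [Set.mem_insert_iff, Set.mem_singleton_iff]; tauto
      rw [hset]
      refine mem_convexHull_of_area (p := -1) (q := -ε) ?_ ?_ ?_ h
      · have := (hε X (by simp) C (by simp)).1 hXC
        linarith
      · have := (hε B (by simp) X (by simp)).1 hBX
        linarith
      · have := not_lt.1 ((hε B (by simp) A (by simp)).not.1 hAB)
        linarith
    rw [e1, e2]
    constructor <;> intro h <;> nlinarith
  · simp [hXC]

open Classical in
/-- The word of the crossings of the segment `AB` with the upward rays from the points `P i`,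
for `A` before `B`; it is trivial otherwise. -/
noncomputable def upWord {n : ℕ} (P : Fin n → Plane) (A B : Plane) : FreeGroup (Fin n) :=
  ((List.finRange n).map fun i => if Crosses (P i) A B then FreeGroup.of i else 1).prod

/-- The word of the crossings of the segment `AB` with the upward rays from the points `P i`. -/
noncomputable def edgeWord {n : ℕ} (P : Fin n → Plane) (A B : Plane) : FreeGroup (Fin n) :=
  upWord P A B * (upWord P B A)⁻¹

theorem upWord_eq_one {n : ℕ} {P : Fin n → Plane} {A B : Plane} (h : ¬ LexLt A B) :
    upWord P A B = 1 := by
  unfold upWord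
  apply List.prod_eq_one
  intro x hx
  obtain ⟨i, -, rfl⟩ := List.mem_map.1 hx
  rw [if_neg]
  rintro ⟨h1, h2, -⟩
  exact h (h1.trans h2)

theorem edgeWord_symm {n : ℕ} (P : Fin n → Plane) (A B : Plane) :
    edgeWord P B A = (edgeWord P A B)⁻¹ := by
  simp [edgeWord]

theorem edgeWord_eq_upWord {n : ℕ} {P : Fin n → Plane} {A B : Plane} (h : ¬ LexLt B A) :
    edgeWord P A B = upWord P A B := by
  simp [edgeWord, upWord_eq_one h]

/-- In the list, the indices with `p` come before those without it. Hence all nontrivial values of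
`f` precede those of `g`, and no commutation is needed. -/
theorem prod_map_mul_of_pairwise {ι G : Type*} [Group G] (p : ι → Prop) (f g k : ι → G)
    (hf : ∀ i, ¬ p i → f i = 1) (hg : ∀ i, p i → g i = 1) (hk : ∀ i, k i = f i * g i)
    (l : List ι) (hl : l.Pairwise fun i j => p j → p i) :
    (l.map k).prod = (l.map f).prod * (l.map g).prod := by
  induction l with
  | nil => simp
  | cons a t ih =>
    rw [List.pairwise_cons] at hl
    simp only [List.map_cons, List.prod_cons, ih hl.2, hk]
    by_cases ha : p a
    · simp [hg a ha, mul_assoc]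
    · have : (t.map f).prod = 1 := List.prod_eq_one fun x hx => by
        obtain ⟨i, hi, rfl⟩ := List.mem_map.1 hx
        exact hf i fun h => ha (hl.1 i hi h)
      simp [this, hf a ha]

/-- The points `P 0, P 1, …` are numbered in the lexicographic order. -/
def LexSorted {n : ℕ} (P : Fin n → Plane) : Prop := ∀ i j, i < j → LexLt (P i) (P j)

theorem not_mem_of_subset_planeMinus {n : ℕ} {P : Fin n → Plane} {s : Set Plane}
    (h : s ⊆ planeMinus P) (i : Fin n) : P i ∉ s :=
  fun hi => h hi ⟨i, rfl⟩

/-- The vertex `B` splits the sorted points: over those before `B` the segment `AC` behaves like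
`AB`, over those after `B` like `BC`. -/
theorem upWord_mul {n : ℕ} {P : Fin n → Plane} (hP : LexSorted P) {A B C : Plane}
    (hAB : ¬ LexLt B A) (hBC : ¬ LexLt C B) (h : convexHull ℝ {A, B, C} ⊆ planeMinus P) :
    upWord P A C = upWord P A B * upWord P B C := by
  classical
  unfold upWord
  have hPi := not_mem_of_subset_planeMinus h
  refine prod_map_mul_of_pairwise (fun i => LexLt (P i) B) _ _ _ ?_ ?_ ?_ _ ?_
  · intro i hi
    rw [if_neg]
    exact fun h => hi h.2.1
  · intro i hi
    rw [if_neg]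
    exact fun h => h.1.asymm hi
  · intro i
    rcases lexLt_trichotomy (P i) B with h' | h' | h'
    · simp only [crosses_iff_left hBC (hPi i) h']
      have : ¬ Crosses (P i) B C := fun h => h.1.asymm h'
      simp [this]
    · exact absurd (subset_convexHull ℝ _ (by simp [h'])) (hPi i)
    · simp only [crosses_iff_right hAB (hPi i) h']
      have : ¬ Crosses (P i) A B := fun h => h.2.1.asymm h'
      simp [this]
  · exact (List.pairwise_lt_finRange n).imp fun hij hj => (hP _ _ hij).trans hj

/-- The crossing words of the sides of a triangle without the points `P i` multiply. -/
theorem edgeWord_mul {n : ℕ} {P : Fin n → Plane} (hP : LexSorted P) {A B C : Plane}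
    (h : convexHull ℝ {A, B, C} ⊆ planeMinus P) :
    edgeWord P A B * edgeWord P B C = edgeWord P A C := by
  -- Only this order of the vertices needs geometry. The others follow by permuting the vertices and
  -- solving for the required product with `edgeWord_symm`.
  have sorted : ∀ A B C : Plane, ¬ LexLt B A → ¬ LexLt C B →
      convexHull ℝ {A, B, C} ⊆ planeMinus P →
      edgeWord P A B * edgeWord P B C = edgeWord P A C := by
    intro A B C hAB hBC h
    have hAC : ¬ LexLt C A := by
      intro h'
      exact hAB (lexLt_of_not_of_lt hBC h')
    rw [edgeWord_eq_upWord hAB, edgeWord_eq_upWord hBC, edgeWord_eq_upWord hAC,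
      upWord_mul hP hAB hBC h]
  have tot : ∀ X Y : Plane, ¬ LexLt X Y ∨ ¬ LexLt Y X := by
    intro X Y
    by_contra hcon
    push Not at hcon
    exact hcon.1.asymm hcon.2
  have sBA := edgeWord_symm P A B
  have sCB := edgeWord_symm P B C
  have sCA := edgeWord_symm P A C
  have perm : ∀ s : Set Plane, s = {A, B, C} → convexHull ℝ s ⊆ planeMinus P := by
    rintro s rfl; exact h
  have solve : ∀ s : Set Plane, (∀ x, x ∈ s ↔ x = A ∨ x = B ∨ x = C) →
      convexHull ℝ s ⊆ planeMinus P := fun s hs => perm s (Set.ext fun x => by simp [hs])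
  rcases tot B A with h1 | h1
  · rcases tot C B with h2 | h2
    · exact sorted A B C h1 h2 h
    · rcases tot C A with h3 | h3
      · have := sorted A C B h3 h2 (solve _ fun x => by simp; tauto)
        rw [← this, sCB]; group
      · have := sorted C A B h3 h1 (solve _ fun x => by simp; tauto)
        rw [sCA, sCB] at this
        rw [← inv_inv (edgeWord P B C), ← this]; group
  · rcases tot C A with h3 | h3
    · have := sorted B A C h1 h3 (solve _ fun x => by simp; tauto)
      rw [← this, sBA]; group
    · rcases tot C B with h2 | h2
      · have := sorted B C A h2 h3 (solve _ fun x => by simp; tauto)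
        rw [sCA, sBA] at this
        rw [← inv_inv (edgeWord P A B), ← this]; group
      · have := sorted C B A h2 h1 (solve _ fun x => by simp; tauto)
        rw [sCA, sBA, sCB] at this
        rw [← inv_inv (edgeWord P A C), ← this]; group

/-! ### Words of closed lines up to conjugation. -/

/-- The product of the words of the edges of a path. -/
def pathWord {G : Type*} [Group G] (w : Plane → Plane → G) : List Plane → G
  | [] => 1
  | [_] => 1
  | A :: B :: l => w A B * pathWord w (B :: l)

/-- The product of the words of the edges of a closed line. -/
def cyclicWord {G : Type*} [Group G] (w : Plane → Plane → G) (l : List Plane) : G :=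
  (List.zipWith w l (l.rotate 1)).prod

theorem zipWith_prod_eq_pathWord {G : Type*} [Group G] (w : Plane → Plane → G) (A B : Plane)
    (l : List Plane) :
    (List.zipWith w (A :: l) (l ++ [B])).prod = pathWord w (A :: l ++ [B]) := by
  induction l generalizing A with
  | nil => simp [pathWord]
  | cons C t ih =>
    simp only [List.cons_append, List.zipWith_cons_cons, List.prod_cons, pathWord]
    rw [ih C, List.cons_append]

theorem cyclicWord_cons {G : Type*} [Group G] (w : Plane → Plane → G) (A : Plane)
    (l : List Plane) : cyclicWord w (A :: l) = pathWord w (A :: l ++ [A]) := by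
  rw [← zipWith_prod_eq_pathWord]
  simp [cyclicWord]

theorem pathWord_append {G : Type*} [Group G] (w : Plane → Plane → G) (l : List Plane) (A : Plane)
    (m : List Plane) :
    pathWord w (l ++ A :: m) = pathWord w (l ++ [A]) * pathWord w (A :: m) := by
  induction l with
  | nil => simp [pathWord]
  | cons B t ih =>
    cases t with
    | nil => cases m <;> simp [pathWord]
    | cons C t => simpa [pathWord, mul_assoc] using ih

/-- Rotation by one vertex moves the word of the first edge from the front to the end, which is
conjugation by that word. -/
theorem isConj_cyclicWord_rotate {G : Type*} [Group G] (w : Plane → Plane → G) {l m : List Plane}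
    (h : l ~r m) : IsConj (cyclicWord w l) (cyclicWord w m) := by
  obtain ⟨k, rfl⟩ := h
  induction k with
  | zero => rw [List.rotate_zero]
  | succ k ih =>
    rw [← List.rotate_rotate]
    refine ih.trans ?_
    generalize l.rotate k = l'
    match l' with
    | [] => exact IsConj.refl _
    | [A] => rw [List.rotate_singleton]
    | A :: B :: t =>
      have : (A :: B :: t).rotate 1 = B :: (t ++ [A]) := by simp
      rw [this, cyclicWord_cons, cyclicWord_cons]
      have e1 : A :: B :: t ++ [A] = [A] ++ B :: (t ++ [A]) := by simp
      have e2 : B :: (t ++ [A]) ++ [B] = (B :: t) ++ A :: [B] := by simp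
      rw [e1, e2, pathWord_append, pathWord_append w (B :: t)]
      refine isConj_iff.2 ⟨(pathWord w ([A] ++ [B]))⁻¹, ?_⟩
      simp

/-- With `B` rotated to the end, its two edges become the last factors of the product and can be
replaced by the closing edge, so the words are even equal. -/
theorem isConj_cyclicWord_of_cancellation {G : Type*} [Group G] (w : Plane → Plane → G)
    (B : Plane) (l : List Plane) (hl : l ≠ [])
    (h : w (l.getLast hl) B * w B (l.head hl) = w (l.getLast hl) (l.head hl)) :
    IsConj (cyclicWord w (B :: l)) (cyclicWord w l) := by
  have e : (B :: l) ~r (l ++ [B]) := List.IsRotated.symm (by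
    simpa using (List.isRotated_append (l := l) (l' := [B])))
  refine (isConj_cyclicWord_rotate w e).trans ?_
  obtain ⟨A, t, rfl⟩ := List.exists_cons_of_ne_nil hl
  have hs : ∀ C, pathWord w (A :: t ++ [C]) =
      pathWord w (A :: t) * w ((A :: t).getLast hl) C := by
    intro C
    obtain ⟨s, D, hsD⟩ := (List.eq_nil_or_concat (A :: t)).resolve_left hl
    simp only [hsD, List.concat_eq_append, List.getLast_append_singleton]
    rw [List.append_assoc, List.singleton_append, pathWord_append]
    simp [pathWord]
  have e1 : cyclicWord w (A :: t ++ [B]) = cyclicWord w (A :: t) := by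
    rw [List.cons_append, cyclicWord_cons, cyclicWord_cons, hs A]
    rw [List.head_cons] at h
    rw [← h]
    have : A :: (t ++ [B]) ++ [A] = (A :: t) ++ B :: [A] := by simp
    rw [this, pathWord_append, hs B]
    simp [pathWord, mul_assoc]
  rw [e1]

/-- The word of a closed line is invariant under homotopy up to conjugation. -/
theorem isConj_of_homotopic {n : ℕ} {P : Fin n → Plane} (hP : LexSorted P)
    {c d : ClosedPolygonalLine (planeMinus P)} (h : Homotopic (planeMinus P) c d)
    {l m : List Plane} (hl : c.1 = (l : Cycle Plane)) (hm : d.1 = (m : Cycle Plane)) :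
    IsConj (cyclicWord (edgeWord P) l) (cyclicWord (edgeWord P) m) := by
  have step : ∀ {c d : ClosedPolygonalLine (planeMinus P)},
      ElementaryCancellation (planeMinus P) c d → ∀ {l m : List Plane},
      c.1 = (l : Cycle Plane) → d.1 = (m : Cycle Plane) →
      IsConj (cyclicWord (edgeWord P) l) (cyclicWord (edgeWord P) m) := by
    rintro c d ⟨B, k, hk, hc, hd, hull⟩ l m hl hm
    have h1 : l ~r (B :: k) := Cycle.coe_eq_coe.1 (hl.symm.trans hc)
    have h2 : k ~r m := Cycle.coe_eq_coe.1 (hd.symm.trans hm)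
    exact (isConj_cyclicWord_rotate _ h1).trans
      ((isConj_cyclicWord_of_cancellation _ B k hk (edgeWord_mul hP hull)).trans
        (isConj_cyclicWord_rotate _ h2))
  induction h generalizing m with
  | refl => exact isConj_cyclicWord_rotate _ (Cycle.coe_eq_coe.1 (hl.symm.trans hm))
  | @tail b d _ hbd ih =>
    obtain ⟨k, hk⟩ := Quotient.exists_rep b.1
    refine (ih hk.symm).trans ?_
    rcases hbd with hbd | hbd
    · exact step hbd hk.symm hm
    · exact (step hbd hm hk.symm).symm

/-! ### The conjugacy problem in free groups. -/

namespace FreeGroup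

variable {α : Type*}

/-- Exchanging the two blocks swaps the junction inside the word with the junction between its end
and its beginning; neither cancels. -/
theorem IsCyclicallyReduced.append_comm {l m : List (α × Bool)}
    (h : IsCyclicallyReduced (l ++ m)) : IsCyclicallyReduced (m ++ l) := by
  rcases List.eq_nil_or_concat l with rfl | ⟨l', a, rfl⟩
  · simpa using h
  rcases m with _ | ⟨b, m'⟩
  · simpa using h
  obtain ⟨h1, h2⟩ := h
  unfold IsReduced at h1
  rw [List.isChain_append] at h1
  refine ⟨?_, ?_⟩
  · unfold IsReduced
    rw [List.isChain_append]
    refine ⟨h1.2.1, h1.1, ?_⟩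
    intro x hx y hy
    refine h2 x ?_ y ?_
    · rw [List.getLast?_append, Option.mem_def.1 hx]; rfl
    · rw [List.head?_append, Option.mem_def.1 hy]; rfl
  · intro x hx y hy
    refine h1.2.2 x ?_ y ?_
    · rw [List.getLast?_append] at hx
      simpa using hx
    · simpa using hy

theorem IsCyclicallyReduced.isRotated {l m : List (α × Bool)}
    (h : IsCyclicallyReduced l) (hlm : l ~r m) : IsCyclicallyReduced m := by
  obtain ⟨n, hn, rfl⟩ := List.isRotated_iff_mod.1 hlm
  rw [List.rotate_eq_drop_append_take hn]
  apply IsCyclicallyReduced.append_comm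
  rwa [List.take_append_drop]

theorem isReduced_invRev {l : List (α × Bool)} (h : IsReduced l) : IsReduced (invRev l) := by
  classical
  rw [isReduced_iff_reduce_eq] at h ⊢
  rw [reduce_invRev, h]

theorem head?_invRev (l : List (α × Bool)) :
    (invRev l).head? = l.getLast?.map fun a => (a.1, !a.2) := by
  simp [invRev]

theorem getLast?_invRev (l : List (α × Bool)) :
    (invRev l).getLast? = l.head?.map fun a => (a.1, !a.2) := by
  simp [invRev]

theorem IsReduced.eq_of_mk_eq {l m : List (α × Bool)} (hl : IsReduced l) (hm : IsReduced m)
    (h : mk l = mk m) : l = m := by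
  classical
  have := reduce.sound h
  rwa [hl.reduce_eq, hm.reduce_eq] at this

/-- Conjugate cyclically reduced words are rotations of each other. -/
theorem IsCyclicallyReduced.isRotated_of_conj (u : List (α × Bool)) (hu : IsReduced u)
    {x y : List (α × Bool)} (hx : IsCyclicallyReduced x) (hy : IsCyclicallyReduced y)
    (h : mk u * mk x * (mk u)⁻¹ = mk y) : x ~r y := by
  -- Induct on the conjugator and peel off its last letter `a`. If `x` begins with the inverse of
  -- `a` or ends with `a`, then `a` is absorbed by rotating `x` by one letter.
  induction u using List.reverseRecOn generalizing x with
  | nil =>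
    have : mk x = mk y := by simpa [← one_eq_mk] using h
    rw [IsReduced.eq_of_mk_eq hx.isReduced hy.isReduced this]
  | append_singleton u a ih =>
    have hu' : IsReduced u := hu.infix ⟨[], [a], by simp⟩
    have hcancel : mk [a] * mk [(a.1, !a.2)] = (1 : FreeGroup α) := by
      rw [mul_mk, one_eq_mk]
      exact Quot.sound (Red.Step.not (L₁ := []) (L₂ := []))
    have hinv : (mk [a])⁻¹ = mk [(a.1, !a.2)] := inv_eq_of_mul_eq_one_right hcancel
    have hsplit : mk (u ++ [a]) = mk u * mk [a] := by rw [mul_mk]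
    rcases x with _ | ⟨c, x'⟩
    · have : mk y = mk [] := by rw [← h, ← one_eq_mk]; group
      rw [IsReduced.eq_of_mk_eq hy.isReduced IsReduced.nil this]
    by_cases hc : c = (a.1, !a.2)
    · have hrot : c :: x' ~r x' ++ [c] := by
        simpa using (List.isRotated_append (l := [c]) (l' := x'))
      refine hrot.trans (ih hu' (hx.isRotated hrot) ?_)
      rw [← h, hsplit]
      have e1 : mk (c :: x') = mk [c] * mk x' := by rw [mul_mk]; rfl
      have e2 : mk (x' ++ [c]) = mk x' * mk [c] := by rw [mul_mk]
      rw [e1, e2, mul_inv_rev, hc, ← hinv]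
      group
    obtain ⟨x'', d, hd⟩ := (List.eq_nil_or_concat (c :: x')).resolve_left (by simp)
    rw [List.concat_eq_append] at hd
    by_cases hda : d = a
    · have hrot : c :: x' ~r d :: x'' := by
        rw [hd]; simpa using (List.isRotated_append (l := x'') (l' := [d]))
      refine hrot.trans (ih hu' (hx.isRotated hrot) ?_)
      rw [← h, hsplit]
      have e1 : mk (c :: x') = mk x'' * mk [d] := by rw [mul_mk, hd]
      have e2 : mk (d :: x'') = mk [d] * mk x'' := by rw [mul_mk]; rfl
      rw [e1, e2, hda]
      group
    · exfalso
      have hlast : (c :: x').getLast? = some d := by rw [hd]; simp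
      -- Otherwise nothing cancels at either junction, so this word is `y`. Its first and last
      -- letters are inverse to each other, although `y` is cyclically reduced.
      have hred : IsReduced ((u ++ [a]) ++ (c :: x') ++ invRev (u ++ [a])) := by
        apply IsReduced.append_overlap _ _ (by simp)
        · unfold IsReduced
          rw [List.isChain_append]
          refine ⟨hu, hx.isReduced, ?_⟩
          intro p hp q hq hpq
          simp only [List.getLast?_append, List.getLast?_singleton, Option.some_or,
            Option.mem_def, Option.some.injEq, List.head?_cons] at hp hq
          subst hp; subst hq
          by_contra hne
          exact hc (Prod.ext hpq.symm (by
            cases h1 : a.2 <;> cases h2 : c.2 <;> simp_all))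
        · unfold IsReduced
          rw [List.isChain_append]
          refine ⟨hx.isReduced, isReduced_invRev hu, ?_⟩
          intro p hp q hq hpq
          rw [hlast] at hp
          rw [head?_invRev] at hq
          simp only [List.getLast?_append, List.getLast?_singleton, Option.some_or,
            Option.mem_def, Option.some.injEq, Option.map_some] at hp hq
          subst hp; subst hq
          by_contra hne
          exact hda (Prod.ext hpq (by
            cases h1 : a.2 <;> cases h2 : d.2 <;> simp_all))
      have heq : (u ++ [a]) ++ (c :: x') ++ invRev (u ++ [a]) = y := by
        apply IsReduced.eq_of_mk_eq hred hy.isReduced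
        rw [← h, inv_mk, mul_mk, mul_mk]
      obtain ⟨b, t, hb⟩ := List.exists_cons_of_ne_nil (l := u ++ [a]) (by simp)
      have h1 : y.head? = some b := by rw [← heq, hb]; simp
      have h2 : y.getLast? = some (b.1, !b.2) := by
        rw [← heq, List.getLast?_append, getLast?_invRev, hb]; simp
      have := hy.2 _ h2 _ h1 rfl
      simp at this

/-- A reduction to a concatenation splits into reductions of two consecutive blocks, and these
blocks can be exchanged before reducing. -/
theorem Red.exists_isRotated {w x y : List (α × Bool)} (h : Red w x) (hxy : x ~r y) :
    ∃ w', w ~r w' ∧ Red w' y := by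
  obtain ⟨n, hn, rfl⟩ := List.isRotated_iff_mod.1 hxy
  rw [← List.take_append_drop n x] at h
  obtain ⟨w1, w2, rfl, h1, h2⟩ := Red.to_append_iff.1 h
  exact ⟨w2 ++ w1, List.isRotated_append, by
    rw [List.rotate_eq_drop_append_take hn]; exact Red.append_append h2 h1⟩

theorem isConj_of_isRotated {w v : List (α × Bool)} (h : w ~r v) : IsConj (mk w) (mk v) := by
  obtain ⟨n, hn, rfl⟩ := List.isRotated_iff_mod.1 h
  rw [List.rotate_eq_drop_append_take hn, ← mul_mk]
  nth_rw 1 [← List.take_append_drop n w]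
  rw [← mul_mk]
  exact isConj_iff.2 ⟨(mk (w.take n))⁻¹, by group⟩

/-- If the reduced form begins and ends with inverse letters, rotating one of them to the other end
lets them cancel. Lifting this rotation to `w` shortens the reduced form. -/
theorem exists_isRotated_isCyclicallyReduced [DecidableEq α] (w : List (α × Bool)) :
    ∃ w', w ~r w' ∧ IsCyclicallyReduced (reduce w') := by
  induction hk : (reduce w).length using Nat.strong_induction_on generalizing w with
  | _ k ih =>
    by_cases hc : IsCyclicallyReduced (reduce w)
    · exact ⟨w, List.IsRotated.refl _, hc⟩
    have hred : IsReduced (reduce w) := isReduced_iff_reduce_eq.2 reduce.idem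
    have hred' : Red w (reduce w) := reduce.red
    generalize reduce w = r at hc hred hred' hk
    induction r using List.bidirectionalRec with
    | nil => exact absurd IsCyclicallyReduced.nil hc
    | singleton a => exact absurd IsCyclicallyReduced.singleton hc
    | cons_append a L b _ =>
      have hab : b.1 = a.1 ∧ b.2 = !a.2 := by
        by_contra hcon
        refine hc (isCyclicallyReduced_cons_append_iff.2 ⟨hred, fun h1 => ?_⟩)
        by_contra h2
        exact hcon ⟨h1, by cases h3 : a.2 <;> cases h4 : b.2 <;> simp_all⟩
      have hb : b = (a.1, !a.2) := Prod.ext hab.1 hab.2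
      have hrot : (a :: (L ++ [b])) ~r L ++ [b] ++ [a] := by
        simpa using (List.isRotated_append (l := [a]) (l' := L ++ [b]))
      obtain ⟨w', hw', hr⟩ := hred'.exists_isRotated hrot
      have hL : Red w' L := hr.trans (by
        have : Red.Step (L ++ (a.1, !a.2) :: (a.1, a.2) :: []) (L ++ []) := Red.Step.not_rev
        rw [hb]
        simpa using this.to_red)
      have hLr : IsReduced L := hred.infix ⟨[a], [b], by simp⟩
      have hw'L : reduce w' = L := by
        rw [reduce.eq_of_red hL, hLr.reduce_eq]
      obtain ⟨w'', h1, h2⟩ := ih L.length (by rw [← hk]; simp) w' (by rw [hw'L])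
      exact ⟨w'', hw'.trans h1, h2⟩

/-- The reduced forms of all rotations of a word. -/
def reducedRotations [DecidableEq α] (w : List (α × Bool)) : List (List (α × Bool)) :=
  (List.range (w.length + 1)).map fun i => reduce (w.drop i ++ w.take i)

/-- The range up to and including `w.length` makes the list nonempty also for the empty word. -/
theorem mem_reducedRotations [DecidableEq α] {w x : List (α × Bool)} :
    x ∈ reducedRotations w ↔ ∃ w', w ~r w' ∧ reduce w' = x := by
  simp only [reducedRotations, List.mem_map, List.mem_range, Nat.lt_succ_iff]
  constructor
  · rintro ⟨i, hi, rfl⟩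
    exact ⟨_, List.isRotated_iff_mod.2 ⟨i, hi, rfl⟩, by
      rw [List.rotate_eq_drop_append_take hi]⟩
  · rintro ⟨w', hw', rfl⟩
    obtain ⟨i, hi, rfl⟩ := List.isRotated_iff_mod.1 hw'
    exact ⟨i, hi, by rw [List.rotate_eq_drop_append_take hi]⟩

/-- Two words are conjugate in the free group if and only if some of their rotations have the same
reduced form. -/
theorem isConj_mk_iff [DecidableEq α] {w v : List (α × Bool)} :
    IsConj (mk w) (mk v) ↔ ∃ x ∈ reducedRotations w, x ∈ reducedRotations v := by
  simp only [mem_reducedRotations]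
  constructor
  · intro h
    obtain ⟨w', hw, hw'⟩ := exists_isRotated_isCyclicallyReduced w
    obtain ⟨v', hv, hv'⟩ := exists_isRotated_isCyclicallyReduced v
    have hc : IsConj (mk (reduce w')) (mk (reduce v')) := by
      rw [reduce.self, reduce.self]
      exact (isConj_of_isRotated hw).symm.trans (h.trans (isConj_of_isRotated hv))
    obtain ⟨c, hc⟩ := isConj_iff.1 hc
    have hrot := IsCyclicallyReduced.isRotated_of_conj c.toWord isReduced_toWord hw' hv'
      (by rwa [mk_toWord])
    -- The cyclically reduced forms are rotations of each other; lifting that rotation to `w'` makes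
    -- the reduced forms equal.
    obtain ⟨w'', h1, h2⟩ := (reduce.red (L := w')).exists_isRotated hrot
    exact ⟨reduce v', ⟨w'', hw.trans h1, by rw [reduce.eq_of_red h2, reduce.idem]⟩, v', hv, rfl⟩
  · rintro ⟨x, ⟨w', hw, rfl⟩, v', hv, hx⟩
    exact (isConj_of_isRotated hw).trans
      (by rw [← reduce.exact hx]; exact (isConj_of_isRotated hv).symm)

end FreeGroup

/-! ### Primitive recursiveness of the conjugacy test. -/

theorem primrec_reduce {α : Type*} [Primcodable α] [DecidableEq α] :
    Primrec (FreeGroup.reduce : List (α × Bool) → List (α × Bool)) := by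
  have step : Primrec fun p : (α × Bool) × List (α × Bool) =>
      (List.casesOn p.2 [p.1] fun hd tl =>
        if p.1.1 = hd.1 ∧ p.1.2 = !hd.2 then tl else p.1 :: hd :: tl : List (α × Bool)) := by
    refine Primrec.list_casesOn
      (h := fun (p : (α × Bool) × List (α × Bool)) (q : (α × Bool) × List (α × Bool)) =>
        if p.1.1 = q.1.1 ∧ p.1.2 = !q.1.2 then q.2 else p.1 :: q.1 :: q.2)
      Primrec.snd (Primrec.list_cons.comp Primrec.fst (Primrec.const [])) ?_
    refine Primrec.ite (PrimrecPred.and ?_ ?_) (Primrec.snd.comp Primrec.snd) ?_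
    · exact Primrec.eq.comp (Primrec.fst.comp (Primrec.fst.comp Primrec.fst))
        (Primrec.fst.comp (Primrec.fst.comp Primrec.snd))
    · exact Primrec.eq.comp (Primrec.snd.comp (Primrec.fst.comp Primrec.fst))
        (Primrec.not.comp (Primrec.snd.comp (Primrec.fst.comp Primrec.snd)))
    · exact Primrec.list_cons.comp (Primrec.fst.comp Primrec.fst)
        (Primrec.list_cons.comp (Primrec.fst.comp Primrec.snd) (Primrec.snd.comp Primrec.snd))
  refine (Primrec.list_foldr Primrec.id (Primrec.const []) (step.comp Primrec.snd).to₂).of_eq ?_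
  intro w
  induction w with
  | nil => rfl
  | cons a t ih =>
    simp only [id, List.foldr_cons] at ih ⊢
    rw [ih, FreeGroup.reduce.cons]

theorem primrec_reducedRotations {α : Type*} [Primcodable α] [DecidableEq α] :
    Primrec (FreeGroup.reducedRotations : List (α × Bool) → List (List (α × Bool))) := by
  refine Primrec.list_map (Primrec.list_range.comp (Primrec.succ.comp Primrec.list_length)) ?_
  exact primrec_reduce.comp (Primrec.list_append.comp
    (Primrec.list_drop.comp Primrec.snd Primrec.fst)
    (Primrec.list_take.comp Primrec.snd Primrec.fst))

/-- The conjugacy test for words in the free group. -/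
def conjTest {α : Type*} [DecidableEq α] (w v : List (α × Bool)) : Bool :=
  decide (∃ x ∈ FreeGroup.reducedRotations w, x ∈ FreeGroup.reducedRotations v)

theorem conjTest_eq_true {α : Type*} [DecidableEq α] {w v : List (α × Bool)} :
    conjTest w v = true ↔ IsConj (FreeGroup.mk w) (FreeGroup.mk v) := by
  rw [FreeGroup.isConj_mk_iff, conjTest, decide_eq_true_iff]

theorem primrec_conjTest {α : Type*} [Primcodable α] [DecidableEq α] :
    Primrec₂ (conjTest : List (α × Bool) → List (α × Bool) → Bool) := by
  have mem : PrimrecRel fun (x : List (α × Bool)) (l : List (List (α × Bool))) => x ∈ l := by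
    have : PrimrecRel fun (l : List (List (α × Bool))) (x : List (α × Bool)) =>
        ∃ y ∈ l, y = x := PrimrecRel.exists_mem_list (R := fun y x => y = x) Primrec.eq
    exact (this.comp Primrec.snd Primrec.fst).of_eq fun p => by simp
  exact (PrimrecRel.exists_mem_list mem).decide.comp
    (primrec_reducedRotations.comp Primrec.fst) (primrec_reducedRotations.comp Primrec.snd)

/-- The code of `k ≥ 0` is `2 k` and that of `-(k + 1)` is `2 k + 1`, so the parity of the code
gives the sign. -/
theorem primrec_toNat : Primrec Int.toNat := by
  have h : Primrec fun z : ℤ =>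
      if Encodable.encode z % 2 = 0 then Encodable.encode z / 2 else 0 := by
    refine Primrec.ite (Primrec.eq.comp (Primrec.nat_mod.comp Primrec.encode (Primrec.const 2))
      (Primrec.const 0)) (Primrec.nat_div.comp Primrec.encode (Primrec.const 2)) (Primrec.const 0)
  refine h.of_eq fun z => ?_
  rcases z with k | k
  · have : Encodable.encode (Int.ofNat k) = 2 * k := rfl
    rw [this, if_pos (by omega)]
    simp
  · have : Encodable.encode (Int.negSucc k) = 2 * k + 1 := rfl
    rw [this, if_neg (by omega)]
    simp

theorem primrec_neg_toNat : Primrec fun z : ℤ => (-z).toNat := by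
  have h : Primrec fun z : ℤ =>
      if Encodable.encode z % 2 = 0 then 0 else Encodable.encode z / 2 + 1 := by
    refine Primrec.ite (Primrec.eq.comp (Primrec.nat_mod.comp Primrec.encode (Primrec.const 2))
      (Primrec.const 0)) (Primrec.const 0)
      (Primrec.succ.comp (Primrec.nat_div.comp Primrec.encode (Primrec.const 2)))
  refine h.of_eq fun z => ?_
  rcases z with k | k
  · have : Encodable.encode (Int.ofNat k) = 2 * k := rfl
    rw [this, if_pos (by omega)]
    simp
  · have : Encodable.encode (Int.negSucc k) = 2 * k + 1 := rfl
    rw [this, if_neg (by omega)]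
    have : -(Int.negSucc k) = ((k + 1 : ℕ) : ℤ) := rfl
    rw [this, Int.toNat_natCast]
    omega

/-! ### The monoid of point sequences up to homotopy. -/

/-- Two cyclic sequences of points are both closed lines in `N` or both not, and they are homotopic
in the former case. -/
def CycEq (N : Set Plane) (c d : Cycle Plane) : Prop :=
  (IsClosedPolygonalLine N c ↔ IsClosedPolygonalLine N d) ∧
    ∀ hc hd, Homotopic N ⟨c, hc⟩ ⟨d, hd⟩

namespace CycEq

variable {N : Set Plane}

theorem refl (c : Cycle Plane) : CycEq N c c :=
  ⟨Iff.rfl, fun _ _ => Relation.ReflTransGen.refl⟩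

theorem symm {c d : Cycle Plane} (h : CycEq N c d) : CycEq N d c :=
  ⟨h.1.symm, fun hd hc =>
    Relation.ReflTransGen.mono (fun _ _ hab => hab.symm) _ _ (h.2 hc hd).swap⟩

theorem trans {c d e : Cycle Plane} (h : CycEq N c d) (h' : CycEq N d e) : CycEq N c e :=
  ⟨h.1.trans h'.1, fun hc he => (h.2 hc (h.1.1 hc)).trans (h'.2 (h.1.1 hc) he)⟩

theorem of_cancellation {B : Plane} {l : List Plane} (hl : l ≠ [])
    (h : convexHull ℝ {l.getLast hl, B, l.head hl} ⊆ N) :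
    CycEq N ((B :: l : List Plane) : Cycle Plane) (l : Cycle Plane) := by
  refine ⟨?_, fun hc hd => .single (Or.inl ⟨B, l, hl, rfl, rfl, h⟩)⟩
  -- All edges that appear or disappear are sides of the triangle, so validity passes in both
  -- directions.
  have seg : ∀ X ∈ ({l.getLast hl, B, l.head hl} : Set Plane),
      ∀ Y ∈ ({l.getLast hl, B, l.head hl} : Set Plane), segment ℝ X Y ⊆ N := fun X hX Y hY =>
    ((convex_convexHull ℝ _).segment_subset (subset_convexHull _ _ hX)
      (subset_convexHull _ _ hY)).trans h
  unfold IsClosedPolygonalLine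
  rw [Cycle.chain_ne_nil _ hl, Cycle.chain_ne_nil _ (List.cons_ne_nil B l),
    List.getLast_cons hl]
  obtain ⟨A, t, rfl⟩ := List.exists_cons_of_ne_nil hl
  simp only [List.isChain_cons_cons]
  simp only [List.head_cons] at seg
  constructor
  · rintro ⟨-, -, -, h3⟩
    exact ⟨by simp, seg _ (by simp) _ (by simp), h3⟩
  · rintro ⟨-, -, h3⟩
    exact ⟨by simp, seg _ (by simp) _ (by simp), seg _ (by simp) _ (by simp), h3⟩

/-- If the edge into `A` lies in `N`, this is a cancellation across a degenerate triangle. Otherwise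
neither sequence is a closed line and the claim is vacuous. -/
theorem of_duplicate (A : Plane) (l : List Plane) :
    CycEq N ((A :: A :: l : List Plane) : Cycle Plane) ((A :: l : List Plane) : Cycle Plane) := by
  by_cases h : segment ℝ ((A :: l).getLast (by simp)) A ⊆ N
  · refine of_cancellation (by simp) ?_
    simpa [convexHull_pair] using h
  · have h1 : ¬ IsClosedPolygonalLine N ((A :: A :: l : List Plane) : Cycle Plane) := by
      rintro ⟨-, h'⟩
      rw [Cycle.chain_ne_nil _ (by simp), List.isChain_cons_cons, List.getLast_cons (by simp)] at h'
      exact h h'.1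
    have h2 : ¬ IsClosedPolygonalLine N ((A :: l : List Plane) : Cycle Plane) := by
      rintro ⟨-, h'⟩
      rw [Cycle.chain_ne_nil _ (by simp), List.isChain_cons_cons] at h'
      exact h h'.1
    exact ⟨⟨fun h => absurd h h1, fun h => absurd h h2⟩, fun h => absurd h h1⟩

end CycEq

/-- Two finite sequences of points are congruent if replacing one by the other in a closed line
gives a homotopic closed line. -/
def lineCon (N : Set Plane) : Con (FreeMonoid Plane) where
  r x y := ∀ p q : List Plane,
    CycEq N ((p ++ x.toList ++ q : List Plane) : Cycle Plane)
      ((p ++ y.toList ++ q : List Plane) : Cycle Plane)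
  iseqv :=
    { refl := fun _ _ _ => CycEq.refl _
      symm := fun h p q => (h p q).symm
      trans := fun h h' p q => (h p q).trans (h' p q) }
  mul' := by
    intro w x y z h h' p q
    have h1 := h p (y.toList ++ q)
    have h2 := h' (p ++ x.toList) q
    simp only [FreeMonoid.toList_mul, ← List.append_assoc] at h1 h2 ⊢
    exact h1.trans h2

/-- The class of a finite sequence of points. -/
def lineClass (N : Set Plane) (l : List Plane) : (lineCon N).Quotient :=
  ((FreeMonoid.ofList l : FreeMonoid Plane) : (lineCon N).Quotient)

/-- The class of a point. -/
def pt (N : Set Plane) (A : Plane) : (lineCon N).Quotient := lineClass N [A]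

/-- Two classes of sequences give homotopic closed lines. -/
def ClassEq (N : Set Plane) (x y : (lineCon N).Quotient) : Prop :=
  ∃ l m : List Plane, lineClass N l = x ∧ lineClass N m = y ∧
    CycEq N (l : Cycle Plane) (m : Cycle Plane)

section

variable {N : Set Plane}

theorem lineClass_append (l m : List Plane) :
    lineClass N (l ++ m) = lineClass N l * lineClass N m := rfl

theorem lineClass_cons (A : Plane) (l : List Plane) :
    lineClass N (A :: l) = pt N A * lineClass N l := rfl

theorem cycEq_of_lineClass_eq {l m : List Plane} (h : lineClass N l = lineClass N m) :
    CycEq N (l : Cycle Plane) (m : Cycle Plane) := by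
  have := (Con.eq (lineCon N)).1 h [] []
  simpa using this

theorem exists_lineClass_eq (x : (lineCon N).Quotient) : ∃ l, lineClass N l = x := by
  induction x using Con.induction_on with
  | H w => exact ⟨w.toList, rfl⟩

theorem ClassEq.cycEq {l m : List Plane} (h : ClassEq N (lineClass N l) (lineClass N m)) :
    CycEq N (l : Cycle Plane) (m : Cycle Plane) := by
  obtain ⟨l', m', hl, hm, h⟩ := h
  exact (cycEq_of_lineClass_eq hl.symm).trans (h.trans (cycEq_of_lineClass_eq hm))

theorem ClassEq.symm {x y : (lineCon N).Quotient} (h : ClassEq N x y) : ClassEq N y x := by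
  obtain ⟨l, m, hl, hm, h⟩ := h
  exact ⟨m, l, hm, hl, h.symm⟩

theorem ClassEq.trans {x y z : (lineCon N).Quotient} (h : ClassEq N x y) (h' : ClassEq N y z) :
    ClassEq N x z := by
  obtain ⟨l, m, hl, rfl, h⟩ := h
  obtain ⟨l', m', hl', hm', h'⟩ := h'
  exact ⟨l, m', hl, hm', h.trans ((cycEq_of_lineClass_eq hl'.symm).trans h')⟩

/-- Closed lines are cyclic, so the two blocks can be rotated past each other. This is what turns
conjugate words into homotopic lines. -/
theorem classEq_mul_comm (x y : (lineCon N).Quotient) : ClassEq N (x * y) (y * x) := by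
  obtain ⟨l, rfl⟩ := exists_lineClass_eq x
  obtain ⟨m, rfl⟩ := exists_lineClass_eq y
  refine ⟨l ++ m, m ++ l, rfl, rfl, ?_⟩
  rw [Cycle.coe_eq_coe.2 (List.isRotated_append (l := l) (l' := m))]
  exact CycEq.refl _

theorem pt_mul_self (A : Plane) : pt N A * pt N A = pt N A := by
  refine (Con.eq (lineCon N)).2 fun p q => ?_
  have r1 : p ++ [A, A] ++ q ~r A :: A :: (q ++ p) := by
    simpa using List.isRotated_append (l := p) (l' := [A, A] ++ q)
  have r2 : p ++ [A] ++ q ~r A :: (q ++ p) := by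
    simpa using List.isRotated_append (l := p) (l' := [A] ++ q)
  have := CycEq.of_duplicate (N := N) A (q ++ p)
  rw [← Cycle.coe_eq_coe.2 r1, ← Cycle.coe_eq_coe.2 r2] at this
  exact this

/-- In any context the line can be read cyclically from `B`; then `C` is the first and `A` the last
of the remaining vertices, as in an elementary cancellation. -/
theorem pt_triangle {A B C : Plane} (h : convexHull ℝ {A, B, C} ⊆ N) :
    pt N A * pt N B * pt N C = pt N A * pt N C := by
  refine (Con.eq (lineCon N)).2 fun p q => ?_
  have r1 : p ++ [A, B, C] ++ q ~r B :: (C :: q ++ p ++ [A]) := by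
    simpa using List.isRotated_append (l := p ++ [A]) (l' := [B, C] ++ q)
  have r2 : p ++ [A, C] ++ q ~r C :: q ++ p ++ [A] := by
    simpa using List.isRotated_append (l := p ++ [A]) (l' := [C] ++ q)
  have := CycEq.of_cancellation (N := N) (B := B) (l := C :: q ++ p ++ [A]) (by simp)
    (by simpa using h)
  rw [← Cycle.coe_eq_coe.2 r1, ← Cycle.coe_eq_coe.2 r2] at this
  exact this

theorem pt_triangle_of_convex {K : Set Plane} (hK : Convex ℝ K) (hN : K ⊆ N) {A B C : Plane}
    (hA : A ∈ K) (hB : B ∈ K) (hC : C ∈ K) : pt N A * pt N B * pt N C = pt N A * pt N C := by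
  refine pt_triangle ((convexHull_min ?_ hK).trans hN)
  rintro X (rfl | rfl | rfl) <;> assumption

theorem pt_backtrack {A B : Plane} (h : segment ℝ A B ⊆ N) :
    pt N A * pt N B * pt N A = pt N A := by
  rw [pt_triangle_of_convex (convex_segment A B) h (left_mem_segment _ _ _)
    (right_mem_segment _ _ _) (left_mem_segment _ _ _),
    pt_mul_self]

end

/-! ### Loops based far below the points. -/

/-- A map of letters to elements invertible with respect to an idempotent `e` extends to the free
group. -/
theorem exists_freeGroup_map {α M : Type*} [Monoid M] (e : M) (f : α × Bool → M)
    (he : e * e = e) (hl : ∀ x, e * f x = f x) (hr : ∀ x, f x * e = f x)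
    (hinv : ∀ a b, f (a, b) * f (a, !b) = e) :
    ∃ φ : FreeGroup α → M, φ 1 = e ∧ (∀ g h, φ (g * h) = φ g * φ h) ∧
      ∀ a, φ (FreeGroup.of a) = f (a, true) := by
  -- Starting the fold at `e` sends the empty word to `e`, which need not be the unit of `M`. A
  -- cancelled pair of letters leaves a factor `e`, which is absorbed.
  let ψ : List (α × Bool) → M := fun l => l.foldr (fun x m => f x * m) e
  have hcons : ∀ x l, ψ (x :: l) = f x * ψ l := fun _ _ => rfl
  have hψ : ∀ l, e * ψ l = ψ l := by
    intro l
    cases l with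
    | nil => exact he
    | cons x t => rw [hcons, ← mul_assoc, hl]
  have happ : ∀ l m, ψ (l ++ m) = ψ l * ψ m := by
    intro l m
    induction l with
    | nil => exact (hψ m).symm
    | cons x t ih => rw [List.cons_append, hcons, hcons, ih, mul_assoc]
  have hstep : ∀ l m, FreeGroup.Red.Step l m → ψ l = ψ m := by
    rintro _ _ ⟨⟩
    rw [happ, happ, hcons, hcons, ← mul_assoc (f _), hinv, hψ]
  refine ⟨Quot.lift ψ hstep, rfl, ?_, fun a => hr _⟩
  rintro ⟨l⟩ ⟨m⟩
  exact happ l m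

/-- The `x`-coordinates of the points `P i` are strictly increasing. -/
def XSorted {n : ℕ} (P : Fin n → Plane) : Prop := ∀ i j, i < j → (P i).1 < (P j).1

theorem XSorted.lexSorted {n : ℕ} {P : Fin n → Plane} (h : XSorted P) : LexSorted P :=
  fun i j hij => lexLt_iff.2 (Or.inl (h i j hij))

theorem edgeWord_eq_one {n : ℕ} {P : Fin n → Plane} {A B : Plane}
    (h : ∀ i, ¬ Crosses (P i) A B ∧ ¬ Crosses (P i) B A) : edgeWord P A B = 1 := by
  simp [edgeWord, upWord, h]

/-- The part of the plane with `x`-coordinate in a closed interval. -/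
theorem convex_strip (a b : ℝ) : Convex ℝ {X : Plane | a ≤ X.1 ∧ X.1 ≤ b} := by
  have : {X : Plane | a ≤ X.1 ∧ X.1 ≤ b} = (LinearMap.fst ℝ ℝ ℝ) ⁻¹' Set.Icc a b := rfl
  rw [this]
  exact (convex_Icc a b).linear_preimage _

theorem convex_low (c : ℝ) : Convex ℝ {X : Plane | X.2 ≤ c} := by
  have : {X : Plane | X.2 ≤ c} = (LinearMap.snd ℝ ℝ ℝ) ⁻¹' Set.Iic c := rfl
  rw [this]
  exact (convex_Iic c).linear_preimage _

theorem convex_high (c : ℝ) : Convex ℝ {X : Plane | c ≤ X.2} := by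
  have : {X : Plane | c ≤ X.2} = (LinearMap.snd ℝ ℝ ℝ) ⁻¹' Set.Ici c := rfl
  rw [this]
  exact (convex_Ici c).linear_preimage _

theorem area_combo (A B X Y : Plane) {a b : ℝ} (h : a + b = 1) :
    area A B (a • X + b • Y) = a * area A B X + b * area A B Y := by
  obtain rfl : a = 1 - b := by linarith
  simp only [area, Prod.fst_add, Prod.snd_add, Prod.smul_fst, Prod.smul_snd, smul_eq_mul]
  ring

theorem convex_area_nonpos (A B : Plane) : Convex ℝ {X : Plane | area A B X ≤ 0} := by
  intro X hX Y hY a b ha hb hab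
  simp only [Set.mem_ofPred_eq] at *
  rw [area_combo A B X Y hab]
  nlinarith

theorem convex_area_nonneg (A B : Plane) : Convex ℝ {X : Plane | 0 ≤ area A B X} := by
  intro X hX Y hY a b ha hb hab
  simp only [Set.mem_ofPred_eq] at *
  rw [area_combo A B X Y hab]
  positivity

theorem subset_planeMinus_iff {n : ℕ} {P : Fin n → Plane} {K : Set Plane} :
    K ⊆ planeMinus P ↔ ∀ i, P i ∉ K := by
  constructor
  · exact not_mem_of_subset_planeMinus
  · rintro h X hX ⟨i, rfl⟩
    exact h i hX

/-- The `x`-coordinate `a` differs from those of the points `P i`. -/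
def Generic {n : ℕ} (P : Fin n → Plane) (a : ℝ) : Prop := ∀ i, (P i).1 ≠ a

theorem exists_generic {n : ℕ} (P : Fin n → Plane) {a b : ℝ} (h : a < b) :
    ∃ c, a < c ∧ c < b ∧ Generic P c := by
  obtain ⟨c, hc, hc'⟩ := ((Set.Ioo_infinite h).sdiff
    (Set.finite_range fun i => (P i).1)).nonempty
  exact ⟨c, hc.1, hc.2, fun i hi => hc' ⟨i, hi⟩⟩

section

variable {n : ℕ} (P : Fin n → Plane) (M : ℝ)

/-- The class of the loop that starts at `(0, -M)`, visits `A` and `B` and comes back, where `A`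
and `B` are joined vertically with the line `y = -M`. -/
def loopClass (A B : Plane) : (lineCon (planeMinus P)).Quotient :=
  pt _ (0, -M) * pt _ (A.1, -M) * pt _ A * pt _ B * pt _ (B.1, -M) * pt _ (0, -M)

variable {P M}

theorem low_triangle (hM : ∀ i, |(P i).2| < M) (a b c : ℝ) :
    pt (planeMinus P) (a, -M) * pt _ (b, -M) * pt _ (c, -M) = pt _ (a, -M) * pt _ (c, -M) := by
  refine pt_triangle_of_convex (convex_low (-M)) ?_ (le_refl (-M)) (le_refl (-M)) (le_refl (-M))
  refine subset_planeMinus_iff.2 fun i (hi : (P i).2 ≤ -M) => ?_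
  have := abs_lt.1 (hM i)
  linarith

theorem high_subset (hM : ∀ i, |(P i).2| < M) : {X : Plane | M ≤ X.2} ⊆ planeMinus P := by
  refine subset_planeMinus_iff.2 fun i (hi : M ≤ (P i).2) => ?_
  have := abs_lt.1 (hM i)
  linarith

theorem vertical_triangle {a : ℝ} (ha : Generic P a) {A B C : Plane} (hA : A.1 = a) (hB : B.1 = a)
    (hC : C.1 = a) :
    pt (planeMinus P) A * pt _ B * pt _ C = pt _ A * pt _ C := by
  refine pt_triangle_of_convex (convex_strip a a) ?_ ⟨hA.ge, hA.le⟩ ⟨hB.ge, hB.le⟩ ⟨hC.ge, hC.le⟩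
  exact subset_planeMinus_iff.2 fun i hi => ha i (le_antisymm hi.2 hi.1)

/-- The trip from `A` down to the line `y = -M`, along it to the base point and back is trivial:
first the horizontal part collapses in the half-plane `y ≤ -M`, then the vertical part in a line
without points. -/
theorem tail_backtrack (hM : ∀ i, |(P i).2| < M) {A : Plane} (hA : Generic P A.1) :
    pt (planeMinus P) A * pt _ (A.1, -M) * pt _ (0, -M) *
      (pt _ (0, -M) * pt _ (A.1, -M) * pt _ A) = pt _ A := by
  have h1 := low_triangle hM A.1 0 A.1
  have h2 := vertical_triangle hA (A := A) (B := (A.1, -M)) (C := A) rfl rfl rfl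
  calc _ = pt (planeMinus P) A * (pt _ (A.1, -M) * (pt _ (0, -M) * pt _ (0, -M)) *
        pt _ (A.1, -M)) * pt _ A := by simp only [mul_assoc]
    _ = _ := by rw [pt_mul_self, h1, pt_mul_self, h2, pt_mul_self]

theorem pt_zero_mul_loopClass (A B : Plane) :
    pt _ (0, -M) * loopClass P M A B = loopClass P M A B := by
  simp only [loopClass, ← mul_assoc, pt_mul_self]

theorem loopClass_mul_pt_zero (A B : Plane) :
    loopClass P M A B * pt _ (0, -M) = loopClass P M A B := by
  simp only [loopClass, mul_assoc, pt_mul_self]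

theorem loopClass_mul (hM : ∀ i, |(P i).2| < M) {A B C : Plane} (hB : Generic P B.1)
    (h : pt (planeMinus P) A * pt _ B * pt _ C = pt _ A * pt _ C) :
    loopClass P M A B * loopClass P M B C = loopClass P M A C := by
  have h1 := tail_backtrack hM hB
  calc _ = pt (planeMinus P) (0, -M) * pt _ (A.1, -M) * pt _ A *
        (pt (planeMinus P) B * pt _ (B.1, -M) * pt _ (0, -M) *
          (pt _ (0, -M) * pt _ (B.1, -M) * pt _ B)) * pt _ C * pt _ (C.1, -M) * pt _ (0, -M) := by
        simp only [loopClass, mul_assoc]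
    _ = pt (planeMinus P) (0, -M) * pt _ (A.1, -M) * (pt _ A * pt _ B * pt _ C) *
          pt _ (C.1, -M) * pt _ (0, -M) := by rw [h1]; simp only [mul_assoc]
    _ = _ := by rw [h]; simp only [loopClass, mul_assoc]

/-- Inside `K` the path through `A` and `B` collapses to the bottom segment between their feet, and
the rest is contractible in the low half-plane. -/
theorem loopClass_eq_of_convex (hM : ∀ i, |(P i).2| < M) {K : Set Plane} (hK : Convex ℝ K)
    (hN : K ⊆ planeMinus P) {A B : Plane} (hA : A ∈ K) (hB : B ∈ K) (hA' : (A.1, -M) ∈ K)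
    (hB' : (B.1, -M) ∈ K) : loopClass P M A B = pt _ (0, -M) := by
  calc _ = pt (planeMinus P) (0, -M) * (pt _ (A.1, -M) * pt _ A * pt _ B) *
        pt _ (B.1, -M) * pt _ (0, -M) := by simp only [loopClass, mul_assoc]
    _ = pt (planeMinus P) (0, -M) * (pt _ (A.1, -M) * pt _ B * pt _ (B.1, -M)) * pt _ (0, -M) := by
        rw [pt_triangle_of_convex hK hN hA' hA hB]; simp only [mul_assoc]
    _ = pt (planeMinus P) (0, -M) * pt _ (A.1, -M) * pt _ (B.1, -M) * pt _ (0, -M) := by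
        rw [pt_triangle_of_convex hK hN hA' hB hB']; simp only [mul_assoc]
    _ = _ := by rw [low_triangle hM, low_triangle hM, pt_mul_self]

theorem loopClass_self (hM : ∀ i, |(P i).2| < M) {A : Plane} (hA : Generic P A.1) :
    loopClass P M A A = pt _ (0, -M) :=
  loopClass_eq_of_convex hM (convex_strip A.1 A.1)
    (subset_planeMinus_iff.2 fun i hi => hA i (le_antisymm hi.2 hi.1)) ⟨le_rfl, le_rfl⟩
    ⟨le_rfl, le_rfl⟩ ⟨le_rfl, le_rfl⟩ ⟨le_rfl, le_rfl⟩

theorem loopClass_mul_symm (hM : ∀ i, |(P i).2| < M) {A B : Plane} (hA : Generic P A.1)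
    (hB : Generic P B.1) (h : segment ℝ A B ⊆ planeMinus P) :
    loopClass P M A B * loopClass P M B A = pt _ (0, -M) := by
  rw [loopClass_mul hM hB, loopClass_self hM hA]
  rw [pt_backtrack h, pt_mul_self]

theorem high_segment (hM : ∀ i, |(P i).2| < M) (a b : ℝ) :
    segment ℝ ((a, M) : Plane) (b, M) ⊆ planeMinus P :=
  ((convex_high M).segment_subset (le_refl M) (le_refl M)).trans (high_subset hM)

theorem loopClass_high_mul (hM : ∀ i, |(P i).2| < M) {a b c : ℝ} (hb : Generic P b) :
    loopClass P M (a, M) (b, M) * loopClass P M (b, M) (c, M) = loopClass P M (a, M) (c, M) :=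
  loopClass_mul hM hb (pt_triangle_of_convex (convex_high M) (high_subset hM) (le_refl M)
    (le_refl M) (le_refl M))

theorem loopClass_eq_one_of_strip (hM : ∀ i, |(P i).2| < M) {A B : Plane}
    (h : ∀ i, ¬ (min A.1 B.1 ≤ (P i).1 ∧ (P i).1 ≤ max A.1 B.1)) :
    loopClass P M A B = pt _ (0, -M) :=
  loopClass_eq_of_convex hM (convex_strip (min A.1 B.1) (max A.1 B.1))
    (subset_planeMinus_iff.2 h) ⟨min_le_left _ _, le_max_left _ _⟩
    ⟨min_le_right _ _, le_max_right _ _⟩ ⟨min_le_left _ _, le_max_left _ _⟩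
    ⟨min_le_right _ _, le_max_right _ _⟩

/-- The part of the strip on or below `AB` is convex, contains no `P i`, and contains both feet. -/
theorem loopClass_of_no_point_below (hM : ∀ i, |(P i).2| < M) {A B : Plane} (hAB : A.1 < B.1)
    (hA : |A.2| ≤ M) (hB : |B.2| ≤ M)
    (h : ∀ i, A.1 ≤ (P i).1 → (P i).1 ≤ B.1 → 0 < area A B (P i)) :
    loopClass P M A B = pt _ (0, -M) := by
  have hA' := (abs_le.1 hA).1
  have hB' := (abs_le.1 hB).1
  refine loopClass_eq_of_convex hM ((convex_strip A.1 B.1).inter (convex_area_nonpos A B))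
    (subset_planeMinus_iff.2 ?_) ⟨⟨le_rfl, hAB.le⟩, ?_⟩ ⟨⟨hAB.le, le_rfl⟩, ?_⟩
    ⟨⟨le_rfl, hAB.le⟩, ?_⟩ ⟨⟨hAB.le, le_rfl⟩, ?_⟩
  · rintro i ⟨⟨h1, h2⟩, h3⟩
    exact absurd (h i h1 h2) (not_lt.2 h3)
  all_goals simp only [Set.mem_ofPred_eq, area]; nlinarith

/-- The part of the strip on or above `AB` is convex and free of points, so `AB` can be pushed up to
height `M` across two triangles; the vertical detours then merge with the ends of the loop. -/
theorem loopClass_of_no_point_above {A B : Plane} (hAB : A.1 < B.1)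
    (hA : |A.2| ≤ M) (hB : |B.2| ≤ M) (gA : Generic P A.1) (gB : Generic P B.1)
    (h : ∀ i, A.1 ≤ (P i).1 → (P i).1 ≤ B.1 → area A B (P i) < 0) :
    loopClass P M A B = loopClass P M (A.1, M) (B.1, M) := by
  have hA' := (abs_le.1 hA).2
  have hB' := (abs_le.1 hB).2
  have hK := (convex_strip A.1 B.1).inter (convex_area_nonneg A B)
  have hN : {X : Plane | A.1 ≤ X.1 ∧ X.1 ≤ B.1} ∩ {X | 0 ≤ area A B X} ⊆ planeMinus P := by
    refine subset_planeMinus_iff.2 ?_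
    rintro i ⟨⟨h1, h2⟩, h3⟩
    exact absurd (h i h1 h2) (not_lt.2 h3)
  have kA : A ∈ {X : Plane | A.1 ≤ X.1 ∧ X.1 ≤ B.1} ∩ {X | 0 ≤ area A B X} :=
    ⟨⟨le_rfl, hAB.le⟩, by simp [area]⟩
  have kB : B ∈ {X : Plane | A.1 ≤ X.1 ∧ X.1 ≤ B.1} ∩ {X | 0 ≤ area A B X} :=
    ⟨⟨hAB.le, le_rfl⟩, by simp only [Set.mem_ofPred_eq, area]; nlinarith⟩
  have kA' : (A.1, M) ∈ {X : Plane | A.1 ≤ X.1 ∧ X.1 ≤ B.1} ∩ {X | 0 ≤ area A B X} :=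
    ⟨⟨le_rfl, hAB.le⟩, by simp only [Set.mem_ofPred_eq, area]; nlinarith⟩
  have kB' : (B.1, M) ∈ {X : Plane | A.1 ≤ X.1 ∧ X.1 ≤ B.1} ∩ {X | 0 ≤ area A B X} :=
    ⟨⟨hAB.le, le_rfl⟩, by simp only [Set.mem_ofPred_eq, area]; nlinarith⟩
  have e1 := pt_triangle_of_convex hK hN kA kA' kB
  have e2 := pt_triangle_of_convex hK hN kA' kB' kB
  have v1 := vertical_triangle gA (A := (A.1, -M)) (B := A) (C := (A.1, M)) rfl rfl rfl
  have v2 := vertical_triangle gB (A := (B.1, M)) (B := B) (C := (B.1, -M)) rfl rfl rfl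
  calc _ = pt (planeMinus P) (0, -M) * pt _ (A.1, -M) * (pt _ A * pt _ B) * pt _ (B.1, -M) *
        pt _ (0, -M) := by simp only [loopClass, mul_assoc]
    _ = pt (planeMinus P) (0, -M) * pt _ (A.1, -M) * pt _ A * (pt _ (A.1, M) * pt _ B) *
        pt _ (B.1, -M) * pt _ (0, -M) := by rw [← e1]; simp only [mul_assoc]
    _ = pt (planeMinus P) (0, -M) * (pt _ (A.1, -M) * pt _ A * pt _ (A.1, M)) *
        (pt _ (B.1, M) * pt _ B * pt _ (B.1, -M)) * pt _ (0, -M) := by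
          rw [← e2]; simp only [mul_assoc]
    _ = _ := by rw [v1, v2]; simp only [loopClass, mul_assoc]

/-- The class of the loop through `A` and `B` is the image of the crossing word of `AB`. -/
theorem exists_map_edgeWord (hP : XSorted P) (hM : ∀ i, |(P i).2| < M) :
    ∃ φ : FreeGroup (Fin n) → (lineCon (planeMinus P)).Quotient,
      φ 1 = pt _ (0, -M) ∧ (∀ g h, φ (g * h) = φ g * φ h) ∧
      ∀ A B : Plane, Generic P A.1 → Generic P B.1 → |A.2| ≤ M → |B.2| ≤ M →
        segment ℝ A B ⊆ planeMinus P → loopClass P M A B = φ (edgeWord P A B) := by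
  classical
  have hPi : Function.Injective fun i => (P i).1 := by
    intro i j hij
    rcases lt_trichotomy i j with h | h | h
    · exact absurd hij (hP i j h).ne
    · exact h
    · exact absurd hij (hP j i h).ne'
  -- Isolate each point in its own vertical strip. The standard loop of the letter `i` will pass
  -- over this strip at height `M`.
  have near : ∀ i, ∃ a b, a < (P i).1 ∧ (P i).1 < b ∧
      ∀ j, a ≤ (P j).1 → (P j).1 ≤ b → j = i := by
    intro i
    have hev : ∀ᶠ δ : ℝ in nhdsWithin 0 (Set.Ioi 0),
        ∀ j, j ≠ i → δ < |(P j).1 - (P i).1| := by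
      rw [Filter.eventually_all]
      intro j
      by_cases hj : j = i
      · simp [hj]
      · have hpos : 0 < |(P j).1 - (P i).1| := abs_pos.2 (sub_ne_zero.2 fun h => hj (hPi h))
        filter_upwards [nhdsWithin_le_nhds (Iio_mem_nhds hpos)] with δ hδ _ using hδ
    obtain ⟨δ, hδ, h0⟩ := (hev.and self_mem_nhdsWithin).exists
    have h0 : 0 < δ := h0
    refine ⟨(P i).1 - δ, (P i).1 + δ, by linarith, by linarith, fun j h1 h2 => ?_⟩
    by_contra hj
    exact absurd (hδ j hj) (not_lt.2 (abs_le.2 ⟨by linarith, by linarith⟩))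
  choose a b hab using near
  have ga : ∀ i, Generic P (a i) := fun i j hj =>
    absurd ((hab i).2.2 j hj.ge (by linarith [hab i])) (by
      rintro rfl; exact (hab j).1.ne' hj)
  have gb : ∀ i, Generic P (b i) := fun i j hj =>
    absurd ((hab i).2.2 j (by linarith [hab i]) hj.le) (by
      rintro rfl; exact (hab j).2.1.ne hj)
  obtain ⟨φ, h1, hmul, hof⟩ := exists_freeGroup_map (α := Fin n) (pt (planeMinus P) (0, -M))
    (fun x => if x.2 then loopClass P M (a x.1, M) (b x.1, M)
      else loopClass P M (b x.1, M) (a x.1, M))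
    (pt_mul_self _)
    (by rintro ⟨i, _ | _⟩ <;> simp [pt_zero_mul_loopClass])
    (by rintro ⟨i, _ | _⟩ <;> simp [loopClass_mul_pt_zero])
    (by
      rintro i (_ | _)
      · simpa using loopClass_mul_symm hM (gb i) (ga i) (high_segment hM _ _)
      · simpa using loopClass_mul_symm hM (ga i) (gb i) (high_segment hM _ _))
  refine ⟨φ, h1, hmul, ?_⟩
  have hinv : ∀ g x, φ g * x = pt _ (0, -M) → pt _ (0, -M) * x = x → x = φ g⁻¹ := by
    intro g x h hx
    have e1 : φ g⁻¹ * (φ g * x) = x := by rw [← mul_assoc, ← hmul, inv_mul_cancel, h1, hx]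
    rw [← e1, h, ← h1, ← hmul, mul_one]
  -- Induct on the number of points in the vertical strip of `AB`. With two or more, `AB` is cut
  -- between two of them; with one, it passes below or above that point.
  have main : ∀ k : ℕ, ∀ A B : Plane, Generic P A.1 → Generic P B.1 → |A.2| ≤ M → |B.2| ≤ M →
      segment ℝ A B ⊆ planeMinus P → A.1 < B.1 →
      (Finset.univ.filter fun i => A.1 < (P i).1 ∧ (P i).1 < B.1).card = k →
      loopClass P M A B = φ (edgeWord P A B) := by
    intro k
    induction k using Nat.strong_induction_on with
    | _ k ih =>
      intro A B gA gB hA hB hseg hAB hk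
      have strict : ∀ i, A.1 ≤ (P i).1 → (P i).1 ≤ B.1 → A.1 < (P i).1 ∧ (P i).1 < B.1 :=
        fun i h1 h2 => ⟨lt_of_le_of_ne h1 (gA i).symm, lt_of_le_of_ne h2 (gB i)⟩
      have hcross : ∀ i, Crosses (P i) A B → A.1 < (P i).1 ∧ (P i).1 < B.1 := by
        rintro i ⟨h1, h2, -⟩
        refine strict i ?_ ?_
        · rcases lexLt_iff.1 h1 with h | h
          · exact h.le
          · exact h.1.le
        · rcases lexLt_iff.1 h2 with h | h
          · exact h.le
          · exact h.1.le
      have hword : edgeWord P A B = upWord P A B :=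
        edgeWord_eq_upWord fun h => h.asymm (lexLt_iff.2 (Or.inl hAB))
      by_cases hex : ∃ i, A.1 < (P i).1 ∧ (P i).1 < B.1
      swap
      · rw [loopClass_eq_one_of_strip hM, hword, upWord, List.prod_eq_one, h1]
        · intro x hx
          obtain ⟨i, -, rfl⟩ := List.mem_map.1 hx
          rw [if_neg fun h => hex ⟨i, hcross i h⟩]
        · rintro i ⟨h2, h3⟩
          rw [min_eq_left hAB.le] at h2
          rw [max_eq_right hAB.le] at h3
          exact hex ⟨i, strict i h2 h3⟩
      obtain ⟨i, hi⟩ := hex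
      by_cases huniq : ∀ j, A.1 < (P j).1 ∧ (P j).1 < B.1 → j = i
      · have hne : area A B (P i) ≠ 0 := by
          intro h0
          have : P i ∈ convexHull ℝ {A, B, B} :=
            mem_convexHull_of_area (p := 1) (q := 0) (by simpa using hi.1) (by simpa using hi.2)
              le_rfl (by rw [h0]; simp)
          rw [Set.pair_eq_singleton, convexHull_pair] at this
          exact not_mem_of_subset_planeMinus hseg i this
        have hupi : upWord P A B = if area A B (P i) < 0 then FreeGroup.of i else 1 := by
          unfold upWord
          rw [List.prod_map_eq_pow_single i, List.count_eq_one_of_mem (List.nodup_finRange n)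
            (List.mem_finRange i), pow_one]
          · refine if_congr ⟨fun h => h.2.2, fun h => ⟨lexLt_iff.2 (Or.inl hi.1),
              lexLt_iff.2 (Or.inl hi.2), h⟩⟩ rfl rfl
          · intro j hj _
            rw [if_neg fun h => hj (huniq j (hcross j h))]
        rw [hword, hupi]
        rcases lt_or_gt_of_ne hne with hlt | hgt
        · rw [if_pos hlt, hof, loopClass_of_no_point_above hAB hA hB gA gB]
          -- Go from `A.1` to `a i`, `b i` and `B.1` at height `M`. The outer pieces are trivial
          -- even if `a i` is left of `A.1` or `b i` is right of `B.1`: no point lies in their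
          -- strips.
          · rw [← loopClass_high_mul hM (ga i) (a := A.1), ← loopClass_high_mul hM (gb i) (a := a i)]
            rw [loopClass_eq_one_of_strip hM (A := (A.1, M)) (B := (a i, M)),
              loopClass_eq_one_of_strip hM (A := (b i, M)) (B := (B.1, M)), loopClass_mul_pt_zero,
              pt_zero_mul_loopClass]
            · simp
            · rintro j ⟨h2, h3⟩
              have hji : j = i := by
                rcases min_le_iff.1 h2 with h2 | h2
                · rcases le_max_iff.1 h3 with h3 | h3
                  · exact absurd (le_antisymm h3 h2) (gb i j)
                  · exact huniq j (strict j (by linarith [hab i]) h3)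
                · rcases le_max_iff.1 h3 with h3 | h3
                  · exact (hab i).2.2 j (by linarith [hab i]) h3
                  · exact absurd (le_antisymm h3 h2) (gB j)
              subst hji
              rcases min_le_iff.1 h2 with h2 | h2
              · linarith [hab j]
              · linarith
            · rintro j ⟨h2, h3⟩
              have hji : j = i := by
                rcases min_le_iff.1 h2 with h2 | h2
                · rcases le_max_iff.1 h3 with h3 | h3
                  · exact absurd (le_antisymm h3 h2) (gA j)
                  · exact huniq j (strict j h2 (by linarith [hab i]))
                · rcases le_max_iff.1 h3 with h3 | h3
                  · exact (hab i).2.2 j h2 (by linarith [hab i])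
                  · exact absurd (le_antisymm h3 h2) (ga i j)
              subst hji
              rcases le_max_iff.1 h3 with h3 | h3
              · linarith
              · linarith [hab j]
          · intro j h2 h3
            rw [huniq j (strict j h2 h3)]; exact hlt
        · rw [if_neg hgt.not_gt, h1]
          refine loopClass_of_no_point_below hM hAB hA hB fun j h2 h3 => ?_
          rw [huniq j (strict j h2 h3)]; exact hgt
      · push Not at huniq
        obtain ⟨j, hj, hji⟩ := huniq
        have split : ∀ p q, A.1 < (P p).1 ∧ (P p).1 < B.1 → A.1 < (P q).1 ∧ (P q).1 < B.1 →
            (P p).1 < (P q).1 → loopClass P M A B = φ (edgeWord P A B) := by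
          intro p q hp hq hpq
          obtain ⟨c, hpc, hcq, gc⟩ := exists_generic P hpq
          -- The cut point of `AB` at the generic abscissa `c`. Each half misses one of the two
          -- points, so both counts drop.
          obtain ⟨C, hC, hCc⟩ : ∃ C ∈ segment ℝ A B, C.1 = c := by
            have hpos : 0 < B.1 - A.1 := by linarith
            refine ⟨AffineMap.lineMap A B ((c - A.1) / (B.1 - A.1)), ?_, ?_⟩
            · rw [segment_eq_image_lineMap]
              refine ⟨_, ⟨by apply div_nonneg <;> linarith, ?_⟩, rfl⟩
              rw [div_le_one hpos]; linarith
            · simp only [AffineMap.lineMap_apply, vsub_eq_sub, vadd_eq_add, Prod.fst_add,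
                Prod.smul_fst, Prod.fst_sub, smul_eq_mul]
              field_simp
              ring
          subst hCc
          have hCM : |C.2| ≤ M := by
            have hconv := ((convex_low M).inter (convex_high (-M))).segment_subset
              (x := A) (y := B) ⟨(abs_le.1 hA).2, (abs_le.1 hA).1⟩
              ⟨(abs_le.1 hB).2, (abs_le.1 hB).1⟩ hC
            exact abs_le.2 ⟨hconv.2, hconv.1⟩
          have hAC : segment ℝ A C ⊆ planeMinus P :=
            ((convex_segment A B).segment_subset (left_mem_segment _ _ _) hC).trans hseg
          have hCB : segment ℝ C B ⊆ planeMinus P :=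
            ((convex_segment A B).segment_subset hC (right_mem_segment _ _ _)).trans hseg
          have hull : convexHull ℝ {A, C, B} ⊆ planeMinus P := by
            refine (convexHull_min ?_ (convex_segment A B)).trans hseg
            rintro X (rfl | rfl | rfl)
            · exact left_mem_segment _ _ _
            · exact hC
            · exact right_mem_segment _ _ _
          rw [← loopClass_mul hM gc (pt_triangle hull), ← edgeWord_mul hP.lexSorted hull, hmul]
          have i1 := ih _ (by
            rw [← hk]
            apply Finset.card_lt_card
            rw [Finset.ssubset_iff_of_subset]
            · exact ⟨q, by simp [hq], by simp [hcq.le]⟩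
            · intro k hk
              simp only [Finset.mem_filter, Finset.mem_univ, true_and] at hk ⊢
              exact ⟨hk.1, by linarith⟩) A C gA gc hA hCM hAC (by linarith) rfl
          have i2 := ih _ (by
            rw [← hk]
            apply Finset.card_lt_card
            rw [Finset.ssubset_iff_of_subset]
            · exact ⟨p, by simp [hp], by simp [hpc.le]⟩
            · intro k hk
              simp only [Finset.mem_filter, Finset.mem_univ, true_and] at hk ⊢
              exact ⟨by linarith, hk.2⟩) C B gc gB hCM hB hCB (by linarith) rfl
          rw [i1, i2]
        rcases lt_trichotomy (P i).1 (P j).1 with h | h | h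
        · exact split i j hi hj h
        · exact absurd (hPi h).symm hji
        · exact split j i hj hi h
  intro A B gA gB hA hB hseg
  rcases lt_trichotomy A.1 B.1 with h | h | h
  · exact main _ A B gA gB hA hB hseg h rfl
  · rw [loopClass_eq_one_of_strip hM, edgeWord_eq_one, h1]
    · intro i
      have key : ∀ A B : Plane, Generic P A.1 → A.1 = B.1 → ¬ Crosses (P i) A B := by
        rintro A B gA h ⟨h2, h3, -⟩
        rcases lexLt_iff.1 h2 with h2 | h2
        · rcases lexLt_iff.1 h3 with h3 | h3
          · linarith
          · exact gA i (h3.1.trans h.symm)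
        · exact gA i h2.1.symm
      exact ⟨key A B gA h, key B A gB h.symm⟩
    · rintro i ⟨h2, h3⟩
      rw [h, min_self] at h2
      rw [h, max_self] at h3
      exact gB i (le_antisymm h3 h2)
  · have hseg' : segment ℝ B A ⊆ planeMinus P := by rwa [segment_symm]
    have := main _ B A gB gA hB hA hseg' h rfl
    rw [edgeWord_symm P B A]
    refine hinv _ _ ?_ (pt_zero_mul_loopClass _ _)
    rw [← this]
    exact loopClass_mul_symm hM gB gA hseg'

/-- A closed line is homotopic to the standard line of its crossing word. -/
theorem classEq_map_cyclicWord (hM : ∀ i, |(P i).2| < M)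
    {φ : FreeGroup (Fin n) → (lineCon (planeMinus P)).Quotient}
    (hmul : ∀ g h, φ (g * h) = φ g * φ h)
    (hφ : ∀ A B : Plane, Generic P A.1 → Generic P B.1 → |A.2| ≤ M → |B.2| ≤ M →
        segment ℝ A B ⊆ planeMinus P → loopClass P M A B = φ (edgeWord P A B))
    {l : List Plane} (hl : IsClosedPolygonalLine (planeMinus P) l)
    (hg : ∀ A ∈ l, Generic P A.1 ∧ |A.2| ≤ M) :
    ClassEq (planeMinus P) (lineClass _ l) (φ (cyclicWord (edgeWord P) l)) := by
  have path : ∀ (t : List Plane) (A Z : Plane),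
      (∀ B ∈ A :: t ++ [Z], Generic P B.1 ∧ |B.2| ≤ M) →
      (A :: t ++ [Z]).IsChain (fun A B => segment ℝ A B ⊆ planeMinus P) →
      pt _ (0, -M) * pt _ (A.1, -M) * lineClass (planeMinus P) (A :: t ++ [Z]) *
        pt _ (Z.1, -M) * pt _ (0, -M) = φ (pathWord (edgeWord P) (A :: t ++ [Z])) := by
    intro t
    induction t with
    | nil =>
      intro A Z hB hc
      have hA := hB A (by simp)
      have hZ := hB Z (by simp)
      simp only [List.cons_append, List.nil_append, List.isChain_cons_cons] at hc
      simp only [List.cons_append, List.nil_append, pathWord, mul_one,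
        ← hφ A Z hA.1 hZ.1 hA.2 hZ.2 hc.1, lineClass_cons, loopClass]
      have : lineClass (planeMinus P) [] = 1 := rfl
      simp only [this, mul_assoc, mul_one]
    | cons B t ih =>
      intro A Z hB hc
      have hA := hB A (by simp)
      have hB' := hB B (by simp)
      simp only [List.cons_append, List.isChain_cons_cons] at hc
      have := ih B Z (fun X hX => hB X (List.mem_cons_of_mem _ hX)) hc.2
      simp only [List.cons_append] at this
      simp only [List.cons_append, pathWord]
      rw [hmul, ← this, ← hφ A B hA.1 hB'.1 hA.2 hB'.2 hc.1, lineClass_cons A,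
        lineClass_cons B]
      -- A trivial excursion to the base point inserted at `B` separates the loop of the first edge
      -- from the rest.
      have hback := tail_backtrack hM hB'.1
      simp only [loopClass]
      calc _ = pt (planeMinus P) (0, -M) * pt _ (A.1, -M) * pt _ A *
            pt (planeMinus P) B * lineClass (planeMinus P) (t ++ [Z]) *
            pt _ (Z.1, -M) * pt _ (0, -M) := by simp only [mul_assoc]
        _ = pt (planeMinus P) (0, -M) * pt _ (A.1, -M) * pt _ A *
            (pt (planeMinus P) B * pt _ (B.1, -M) * pt _ (0, -M) *
              (pt _ (0, -M) * pt _ (B.1, -M) * pt _ B)) * lineClass (planeMinus P) (t ++ [Z]) *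
            pt _ (Z.1, -M) * pt _ (0, -M) := by rw [hback]
        _ = _ := by simp only [mul_assoc]
  obtain ⟨hne, hchain⟩ := hl
  rcases l with _ | ⟨A, t⟩
  · exact absurd rfl hne
  rw [Cycle.chain_coe_cons] at hchain
  have hA := hg A (by simp)
  rw [cyclicWord_cons, ← path t A A (fun B hB => hg B (by
    simp only [List.cons_append, List.mem_cons, List.mem_append, List.not_mem_nil, or_false] at hB ⊢
    tauto)) hchain]
  have hback := tail_backtrack hM hA.1
  -- Rotating the return to the base point to the front creates a trivial excursion at `A`, which is
  -- removed by `hback`.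
  have h := classEq_mul_comm (N := planeMinus P)
    (pt _ A * pt _ (A.1, -M) * pt _ (0, -M)) (pt _ (0, -M) * pt _ (A.1, -M) *
      (pt _ A * lineClass _ t))
  have e1 : pt (planeMinus P) A * pt _ (A.1, -M) * pt _ (0, -M) * (pt _ (0, -M) * pt _ (A.1, -M) *
      (pt _ A * lineClass _ t)) = lineClass _ (A :: t) := by
    rw [lineClass_cons]
    nth_rw 3 [← hback]
    simp only [mul_assoc]
  rw [e1] at h
  refine (Eq.subst (motive := fun y => ClassEq (planeMinus P) (lineClass _ (A :: t)) y) ?_ h)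
  rw [lineClass_append, lineClass_cons]
  change _ = _ * (_ * _ * pt _ A) * _ * _
  simp only [mul_assoc]

end

/-! ### From conjugate words to homotopies. -/

/-- Lines with conjugate crossing words are homotopic, when the points `P i` and the vertices of
the lines are in general position. -/
theorem homotopic_of_isConj_of_generic {n : ℕ} {P : Fin n → Plane} (hP : XSorted P)
    {l m : List Plane}
    (hl : IsClosedPolygonalLine (planeMinus P) l) (hm : IsClosedPolygonalLine (planeMinus P) m)
    (hg : ∀ A ∈ l ++ m, Generic P A.1)
    (h : IsConj (cyclicWord (edgeWord P) l) (cyclicWord (edgeWord P) m)) :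
    Homotopic (planeMinus P) ⟨_, hl⟩ ⟨_, hm⟩ := by
  obtain ⟨M, hM⟩ : ∃ M : ℝ, ∀ A ∈ List.ofFn P ++ (l ++ m), |A.2| < M := by
    generalize List.ofFn P ++ (l ++ m) = s
    induction s with
    | nil => exact ⟨0, by simp⟩
    | cons A t ih =>
      obtain ⟨M, hM⟩ := ih
      refine ⟨max M (|A.2| + 1), fun B hB => ?_⟩
      rcases List.mem_cons.1 hB with rfl | hB
      · exact lt_max_of_lt_right (lt_add_one _)
      · exact lt_max_of_lt_left (hM B hB)
  have hMP : ∀ i, |(P i).2| < M := fun i => hM _ (by simp [List.mem_ofFn])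
  obtain ⟨φ, -, hmul, hφ⟩ := exists_map_edgeWord hP hMP
  have hgM : ∀ A ∈ l ++ m, Generic P A.1 ∧ |A.2| ≤ M := fun A hA =>
    ⟨hg A hA, (hM A (List.mem_append_right _ hA)).le⟩
  have hl' := classEq_map_cyclicWord hMP hmul hφ hl fun A hA => hgM A (by simp [hA])
  have hm' := classEq_map_cyclicWord hMP hmul hφ hm fun A hA => hgM A (by simp [hA])
  obtain ⟨c, hc⟩ := isConj_iff.1 h
  have key : ClassEq (planeMinus P) (φ (cyclicWord (edgeWord P) l))
      (φ (cyclicWord (edgeWord P) m)) := by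
    have := classEq_mul_comm (N := planeMinus P) (φ (cyclicWord (edgeWord P) l) * φ c⁻¹) (φ c)
    rw [← hmul, ← hmul, ← hmul, inv_mul_cancel_right, ← mul_assoc, hc] at this
    exact this
  exact ((hl'.trans key).trans hm'.symm).cycEq.2 hl hm

/-- The image of a closed line under a linear map. -/
theorem IsClosedPolygonalLine.map {N N' : Set Plane} (f : Plane →ₗ[ℝ] Plane)
    (hf : Set.MapsTo f N N') {c : Cycle Plane} (hc : IsClosedPolygonalLine N c) :
    IsClosedPolygonalLine N' (c.map f) := by
  refine ⟨fun h => hc.1 ?_, ?_⟩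
  · induction c using Quotient.inductionOn with
    | _ l =>
      have h' : ((l.map f : List Plane) : Cycle Plane) = Cycle.nil := h
      rw [Cycle.coe_eq_nil, List.map_eq_nil_iff] at h'
      exact (Cycle.coe_eq_nil l).2 h'
  · rw [Cycle.chain_map]
    refine hc.2.imp fun A B hAB => ?_
    rw [← LinearMap.coe_toAffineMap, ← image_segment]
    exact Set.image_subset_iff.2 fun X hX => hf (hAB hX)

theorem Homotopic.map {N N' : Set Plane} (f : Plane →ₗ[ℝ] Plane) (hf : Set.MapsTo f N N')
    {c d : ClosedPolygonalLine N} (h : Homotopic N c d) :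
    Homotopic N' ⟨c.1.map f, c.2.map f hf⟩ ⟨d.1.map f, d.2.map f hf⟩ := by
  have step : ∀ {c d : ClosedPolygonalLine N}, ElementaryCancellation N c d →
      ElementaryCancellation N' ⟨c.1.map f, c.2.map f hf⟩ ⟨d.1.map f, d.2.map f hf⟩ := by
    rintro c d ⟨B, l, hl, hc, hd, hull⟩
    refine ⟨f B, l.map f, by simpa using hl, ?_, ?_, ?_⟩
    · simp only [hc]; rfl
    · simp only [hd]; rfl
    · have : ({(l.map f).getLast (by simpa using hl), f B, (l.map f).head (by simpa using hl)} :
          Set Plane) = f '' {l.getLast hl, B, l.head hl} := by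
        simp [Set.image_insert_eq, List.getLast_map, List.head_map]
      rw [this, ← LinearMap.image_convexHull]
      exact Set.image_subset_iff.2 fun X hX => hf (hull hX)
  induction h with
  | refl => exact Relation.ReflTransGen.refl
  | tail _ hbd ih => exact ih.tail (hbd.imp step step)

theorem upWord_congr {n : ℕ} {P P' : Fin n → Plane} {A B A' B' : Plane}
    (h : ∀ i, Crosses (P i) A B ↔ Crosses (P' i) A' B') : upWord P A B = upWord P' A' B' := by
  classical
  unfold upWord
  congr 2
  funext i
  exact if_congr (h i) rfl rfl

theorem edgeWord_congr {n : ℕ} {P P' : Fin n → Plane} {A B A' B' : Plane}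
    (h : ∀ i, Crosses (P i) A B ↔ Crosses (P' i) A' B')
    (h' : ∀ i, Crosses (P i) B A ↔ Crosses (P' i) B' A') :
    edgeWord P A B = edgeWord P' A' B' := by
  rw [edgeWord, edgeWord, upWord_congr h, upWord_congr h']

/-- Every vertex is the end of the edge that enters it. -/
theorem IsClosedPolygonalLine.mem {N : Set Plane} {l : List Plane}
    (hl : IsClosedPolygonalLine N l) {A : Plane} (hA : A ∈ l) : A ∈ N := by
  have aux : ∀ (l : List Plane) (Z : Plane),
      (Z :: l).IsChain (fun A B => segment ℝ A B ⊆ N) → ∀ A ∈ l, A ∈ N := by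
    intro l
    induction l with
    | nil => simp
    | cons B t ih =>
      intro Z h A hA
      rw [List.isChain_cons_cons] at h
      rcases List.mem_cons.1 hA with rfl | hA
      · exact h.1 (right_mem_segment _ _ _)
      · exact ih B h.2 A hA
  have := hl.2
  rw [Cycle.chain_ne_nil _ (List.ne_nil_of_mem hA)] at this
  exact aux l _ this A hA

/-- The shear `(x, y) ↦ (x + ε y, y)`. -/
def shear (ε : ℝ) : Plane →ₗ[ℝ] Plane :=
  (LinearMap.fst ℝ ℝ ℝ + ε • LinearMap.snd ℝ ℝ ℝ).prod (LinearMap.snd ℝ ℝ ℝ)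

theorem shear_apply (ε : ℝ) (A : Plane) : shear ε A = (A.1 + ε * A.2, A.2) := rfl

theorem shear_neg_shear (ε : ℝ) (A : Plane) : shear (-ε) (shear ε A) = A := by
  simp [shear_apply]

theorem shear_shear_neg (ε : ℝ) (A : Plane) : shear ε (shear (-ε) A) = A := by
  simp [shear_apply]

theorem area_shear (ε : ℝ) (A B C : Plane) :
    area (shear ε A) (shear ε B) (shear ε C) = area A B C := by
  simp only [area, shear_apply]
  ring

theorem cyclicWord_map {G : Type*} [Group G] {w w' : Plane → Plane → G} {f : Plane → Plane}
    {l : List Plane} (h : ∀ A ∈ l, ∀ B ∈ l, w' (f A) (f B) = w A B) :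
    cyclicWord w' (l.map f) = cyclicWord w l := by
  unfold cyclicWord
  rw [← List.map_rotate, List.zipWith_map]
  congr 1
  apply List.ext_getElem (by simp)
  intro i h1 h2
  simp only [List.getElem_zipWith]
  exact h _ (List.getElem_mem _) _ (by
    rw [← List.mem_rotate (n := 1)]; exact List.getElem_mem _)

/-- For points in lexicographic order, two closed lines are homotopic if and only if their crossing
words are conjugate. -/
theorem homotopic_iff_isConj {n : ℕ} {P : Fin n → Plane} (hP : LexSorted P) {l m : List Plane}
    (hl : IsClosedPolygonalLine (planeMinus P) l) (hm : IsClosedPolygonalLine (planeMinus P) m) :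
    Homotopic (planeMinus P) ⟨_, hl⟩ ⟨_, hm⟩ ↔
      IsConj (cyclicWord (edgeWord P) l) (cyclicWord (edgeWord P) m) := by
  classical
  refine ⟨fun h => isConj_of_homotopic hP h rfl rfl, fun h => ?_⟩
  obtain ⟨ε, -, hε⟩ := exists_functional (List.ofFn P ++ (l ++ m)).toFinset
  simp only [List.mem_toFinset] at hε
  have memP : ∀ i, P i ∈ List.ofFn P ++ (l ++ m) := fun i => by simp [List.mem_ofFn]
  have lex : ∀ A ∈ List.ofFn P ++ (l ++ m), ∀ B ∈ List.ofFn P ++ (l ++ m),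
      LexLt (shear ε A) (shear ε B) ↔ LexLt A B := by
    have imp : ∀ A ∈ List.ofFn P ++ (l ++ m), ∀ B ∈ List.ofFn P ++ (l ++ m),
        LexLt A B → LexLt (shear ε A) (shear ε B) := fun A hA B hB h =>
      lexLt_iff.2 (Or.inl ((hε A hA B hB).1 h))
    intro A hA B hB
    refine ⟨fun h => ?_, imp A hA B hB⟩
    rcases lexLt_trichotomy A B with h' | rfl | h'
    · exact h'
    · exact absurd h (LexLt.irrefl _)
    · exact absurd h (imp B hB A hA h').asymm
  -- The functional `x + ε y` is the first coordinate after the shear, so the lexicographic order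
  -- becomes the strict order of abscissas.
  have hQ : XSorted (fun i => shear ε (P i)) := fun i j hij =>
    (hε _ (memP i) _ (memP j)).1 (hP i j hij)
  have word : ∀ A ∈ List.ofFn P ++ (l ++ m), ∀ B ∈ List.ofFn P ++ (l ++ m),
      edgeWord (fun i => shear ε (P i)) (shear ε A) (shear ε B) = edgeWord P A B := by
    intro A hA B hB
    refine edgeWord_congr (fun i => ?_) (fun i => ?_) <;>
      simp only [Crosses, area_shear, lex _ hA _ (memP _), lex _ hB _ (memP _),
        lex _ (memP _) _ hA, lex _ (memP _) _ hB]
  have hwl : cyclicWord (edgeWord fun i => shear ε (P i)) (l.map (shear ε)) =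
      cyclicWord (edgeWord P) l := cyclicWord_map fun A hA B hB =>
    word A (by simp [hA]) B (by simp [hB])
  have hwm : cyclicWord (edgeWord fun i => shear ε (P i)) (m.map (shear ε)) =
      cyclicWord (edgeWord P) m := cyclicWord_map fun A hA B hB =>
    word A (by simp [hA]) B (by simp [hB])
  have maps : Set.MapsTo (shear ε) (planeMinus P) (planeMinus fun i => shear ε (P i)) := by
    rintro X hX ⟨i, hi⟩
    refine hX ⟨i, ?_⟩
    have := congrArg (shear (-ε)) hi
    simpa only [shear_neg_shear] using this
  have maps' : Set.MapsTo (shear (-ε)) (planeMinus fun i => shear ε (P i)) (planeMinus P) := by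
    rintro X hX ⟨i, hi⟩
    refine hX ⟨i, ?_⟩
    have := congrArg (shear ε) hi
    simpa only [shear_shear_neg] using this
  -- A vertex differs from every `P i`, hence is lexicographically comparable to it, and the
  -- functional separates them.
  have generic : ∀ A ∈ l ++ m, Generic (fun i => shear ε (P i)) (shear ε A).1 := by
    intro A hA i hi
    have hA' : A ∈ List.ofFn P ++ (l ++ m) := List.mem_append_right _ hA
    have hAN : A ∈ planeMinus P := by
      rcases List.mem_append.1 hA with h | h
      · exact hl.mem h
      · exact hm.mem h
    rcases lexLt_trichotomy A (P i) with h | h | h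
    · exact absurd hi ((hε _ hA' _ (memP i)).1 h).ne'
    · exact hAN ⟨i, h.symm⟩
    · exact absurd hi ((hε _ (memP i) _ hA').1 h).ne
  have key := homotopic_of_isConj_of_generic hQ (l := l.map (shear ε)) (m := m.map (shear ε))
    (hl.map _ maps) (hm.map _ maps) (by
      intro A hA
      rw [← List.map_append] at hA
      obtain ⟨B, hB, rfl⟩ := List.mem_map.1 hA
      exact generic B hB) (by rwa [hwl, hwm])
  have back := key.map _ maps'
  have hid : ∀ k : List Plane,
      Cycle.map (shear (-ε)) ((k.map (shear ε) : List Plane) : Cycle Plane) = k := by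
    intro k
    rw [Cycle.map_coe, List.map_map]
    congr 1
    exact (List.map_congr_left fun A _ => shear_neg_shear ε A).trans (List.map_id k)
  simpa only [hid] using back

/-! ### Crossing words from finitely many sign tests. -/

/-- A numbering of the points `P i` in lexicographic order. -/
noncomputable def sortPerm {n : ℕ} (P : Fin n → Plane) : Equiv.Perm (Fin n) :=
  Classical.epsilon fun σ : Equiv.Perm (Fin n) => ∀ i j, i < j → LexLt (P (σ i)) (P (σ j))

theorem lexSorted_sortPerm {n : ℕ} {P : Fin n → Plane} (hP : Function.Injective P) :
    LexSorted (P ∘ sortPerm P) := by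
  have hex : ∃ σ : Equiv.Perm (Fin n), ∀ i j, i < j → LexLt (P (σ i)) (P (σ j)) := by
    refine ⟨Tuple.sort fun i => toLex (P i), fun i j hij => ?_⟩
    refine lt_of_le_of_ne (Tuple.monotone_sort (fun i => toLex (P i)) hij.le) fun h => ?_
    exact hij.ne ((Tuple.sort _).injective (hP (toLex.injective h)))
  exact Classical.epsilon_spec hex

theorem planeMinus_comp_perm {n : ℕ} (P : Fin n → Plane) (σ : Equiv.Perm (Fin n)) :
    planeMinus (P ∘ σ) = planeMinus P := by
  unfold planeMinus
  rw [σ.surjective.range_comp]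

/-- The crossing word of the segment `AB`, where the points `P i` are first put in lexicographic
order. -/
noncomputable def sortedEdgeWord {n : ℕ} (P : Fin n → Plane) (A B : Plane) : FreeGroup (Fin n) :=
  edgeWord (P ∘ sortPerm P) A B

theorem homotopic_iff_isConj_sorted {n : ℕ} {P : Fin n → Plane} (hP : Function.Injective P)
    {l m : List Plane} (hl : IsClosedPolygonalLine (planeMinus P) l)
    (hm : IsClosedPolygonalLine (planeMinus P) m) :
    Homotopic (planeMinus P) ⟨_, hl⟩ ⟨_, hm⟩ ↔
      IsConj (cyclicWord (sortedEdgeWord P) l) (cyclicWord (sortedEdgeWord P) m) := by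
  have key := fun hl hm => homotopic_iff_isConj (lexSorted_sortPerm hP) (l := l) (m := m) hl hm
  rw [planeMinus_comp_perm] at key
  exact key hl hm

/-- The indices of the sign tests that determine the relative position of two vertices and the
`n` points. -/
abbrev TestIndex (n : ℕ) : Type := Fin (n + 2) × Fin (n + 2) × Fin (n + 2) × Fin 3

/-- The number of sign tests for one edge. -/
def testCount (n : ℕ) : ℕ := Fintype.card (TestIndex n)

/-- An enumeration of the sign tests for one edge. -/
noncomputable def testEquiv (n : ℕ) : Fin (testCount n) ≃ TestIndex n :=
  (Fintype.equivFin (TestIndex n)).symm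

/-- The two vertices of an edge, followed by the `n` points. -/
def config {n : ℕ} {X : Type*} (P : Fin n → X) (A B : X) : Fin (n + 2) → X :=
  Fin.cons A (Fin.cons B P : Fin (n + 1) → X)

/-- The real numbers whose signs are tested. -/
def testValue (k : Fin 3) (U V W : Plane) : ℝ :=
  ![V.1 - U.1, V.2 - U.2, - area U V W] k

open Classical in
/-- The results of all sign tests for one edge. -/
noncomputable def answers {n : ℕ} (R : Fin (n + 2) → Plane) (j : Fin (testCount n)) : Bool :=
  decide (0 < testValue (testEquiv n j).2.2.2 (R (testEquiv n j).1) (R (testEquiv n j).2.1)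
    (R (testEquiv n j).2.2.1))

theorem testValue_pos_iff {n : ℕ} {R R' : Fin (n + 2) → Plane} (h : answers R = answers R')
    (k : Fin 3) (u v w : Fin (n + 2)) :
    0 < testValue k (R u) (R v) (R w) ↔ 0 < testValue k (R' u) (R' v) (R' w) := by
  have := congrFun h ((testEquiv n).symm (u, v, w, k))
  simpa [answers] using this

/-- Equality of abscissas is not tested directly: once `A.1 < B.1` is excluded, it is the failure of
`B.1 < A.1`. -/
theorem lexLt_iff_of_answers {n : ℕ} {R R' : Fin (n + 2) → Plane} (h : answers R = answers R')
    (u v : Fin (n + 2)) : LexLt (R u) (R v) ↔ LexLt (R' u) (R' v) := by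
  have h1 := testValue_pos_iff h 0 u v u
  have h2 := testValue_pos_iff h 0 v u u
  have h3 := testValue_pos_iff h 1 u v u
  simp only [testValue, Matrix.cons_val_zero, Matrix.cons_val_one, sub_pos] at h1 h2 h3
  have key : ∀ A B : Plane, LexLt A B ↔ A.1 < B.1 ∨ (¬ B.1 < A.1 ∧ A.2 < B.2) := by
    intro A B
    rw [lexLt_iff]
    rcases lt_trichotomy A.1 B.1 with h | h | h
    · simp [h]
    · simp [h]
    · simp [h, h.not_gt, h.ne']
  rw [key, key, h1, h2, h3]

theorem area_neg_iff_of_answers {n : ℕ} {R R' : Fin (n + 2) → Plane} (h : answers R = answers R')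
    (u v w : Fin (n + 2)) : area (R u) (R v) (R w) < 0 ↔ area (R' u) (R' v) (R' w) < 0 := by
  have h1 := testValue_pos_iff h 2 u v w
  simpa [testValue] using h1

/-- The letters of the crossing word of an edge. -/
noncomputable def configLetters {n : ℕ} (R : Fin (n + 2) → Plane) : List (Fin n × Bool) :=
  (sortedEdgeWord (fun i => R i.succ.succ) (R 0) (R 1)).toWord

/-- Both the sorting permutation and the crossings are expressed by lexicographic comparisons and
signs of areas only. -/
theorem configLetters_factorsThrough (n : ℕ) :
    Function.FactorsThrough (configLetters (n := n)) answers := by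
  intro R R' h
  have hlex := lexLt_iff_of_answers h
  have harea := area_neg_iff_of_answers h
  -- The choice operator is applied to a predicate formulated with `LexLt` alone, so equal
  -- comparisons give the very same permutation.
  have hperm : sortPerm (fun i : Fin n => R i.succ.succ) =
      sortPerm (fun i : Fin n => R' i.succ.succ) := by
    simp only [sortPerm, hlex]
  unfold configLetters sortedEdgeWord
  rw [hperm]
  congr 1
  refine edgeWord_congr (fun i => ?_) (fun i => ?_) <;>
    simp only [Crosses, Function.comp, hlex, harea]

/-- The crossing word of an edge as a function of the results of the sign tests. -/
noncomputable def lettersOf {n : ℕ} : (Fin (testCount n) → Bool) → List (Fin n × Bool) :=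
  Function.extend answers configLetters fun _ => []

theorem lettersOf_answers {n : ℕ} (P : Fin n → Plane) (A B : Plane) :
    FreeGroup.mk (lettersOf (answers (config P A B))) = sortedEdgeWord P A B := by
  rw [lettersOf, (configLetters_factorsThrough n).extend_apply, configLetters,
    FreeGroup.mk_toWord]
  rfl

/-- The crossing word of a closed line with `a` vertices, where `g i j` are the results of the sign
tests for the vertices number `i` and `j`. -/
noncomputable def lineLetters {n : ℕ} (g : ℕ → ℕ → Fin (testCount n) → Bool) (a : ℕ) :
    List (Fin n × Bool) :=
  (List.range a).flatMap fun i => lettersOf (g i ((i + 1) % a))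

theorem mk_flatMap {α β : Type*} (l : List β) (f : β → List (α × Bool)) :
    FreeGroup.mk (l.flatMap f) = (l.map fun b => FreeGroup.mk (f b)).prod := by
  induction l with
  | nil => rfl
  | cons b t ih => rw [List.flatMap_cons, ← FreeGroup.mul_mk, ih, List.map_cons, List.prod_cons]

theorem mk_lineLetters {n : ℕ} {P : Fin n → Plane} {l : List Plane}
    {g : ℕ → ℕ → Fin (testCount n) → Bool}
    (hg : ∀ i, i < l.length →
      g i ((i + 1) % l.length) =
        answers (config P (l.getD i 0) (l.getD ((i + 1) % l.length) 0))) :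
    FreeGroup.mk (lineLetters g l.length) = cyclicWord (sortedEdgeWord P) l := by
  rw [lineLetters, mk_flatMap, cyclicWord]
  congr 1
  apply List.ext_getElem (by simp)
  intro i h1 h2
  have hi : i < l.length := by simpa using h1
  have hi' : (i + 1) % l.length < l.length := Nat.mod_lt _ (by omega)
  simp only [List.getElem_map, List.getElem_range, List.getElem_zipWith, List.getElem_rotate]
  rw [hg i hi, lettersOf_answers, List.getD_eq_getElem _ _ hi, List.getD_eq_getElem _ _ hi']

theorem primrec_pi {α σ : Type*} [Primcodable α] [Primcodable σ] {k : ℕ} {f : α → Fin k → σ}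
    (h : ∀ i, Primrec fun a => f a i) : Primrec f :=
  Primrec.fin_curry.2 ((Primrec.fin_curry₁ (f := fun i a => f a i)).2 h).swap

theorem primrec_lineLetters {n : ℕ} {α : Type*} [Primcodable α]
    {g : α → ℕ → ℕ → Fin (testCount n) → Bool} {a : α → ℕ} (ha : Primrec a)
    (hg : ∀ t, Primrec fun p : α × ℕ × ℕ => g p.1 p.2.1 p.2.2 t) :
    Primrec fun x => lineLetters (g x) (a x) := by
  refine Primrec.list_flatMap (Primrec.list_range.comp ha) ?_
  -- Although defined by choice, `lettersOf` has a finite domain, hence is a lookup table.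
  refine (Primrec.dom_finite lettersOf).comp (primrec_pi fun t => ?_)
  exact (hg t).comp (Primrec.pair Primrec.fst (Primrec.pair Primrec.snd
    (Primrec.nat_mod.comp (Primrec.succ.comp Primrec.snd) (ha.comp Primrec.fst))))

theorem primrec_config {n : ℕ} {α X : Type*} [Primcodable α] [Primcodable X]
    {P : α → Fin n → X} {A B : α → X} (hP : Primrec P) (hA : Primrec A) (hB : Primrec B)
    (w : Fin (n + 2)) : Primrec fun x => config (P x) (A x) (B x) w := by
  refine Fin.cases ?_ (fun w => ?_) w
  · exact hA
  · refine Fin.cases ?_ (fun w => ?_) w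
    · exact hB
    · have h : Primrec fun x => P x w := Primrec.fin_app.comp hP (Primrec.const w)
      exact h

/-! ### Rational data -/

/-- A fraction `((a, b), d)` describes the rational number `(a - b) / (d + 1)`. -/
abbrev Frac : Type := (ℕ × ℕ) × ℕ

namespace Frac

/-- The value of a fraction. -/
noncomputable def val (x : Frac) : ℝ := ((x.1.1 : ℝ) - x.1.2) / (x.2 + 1)

/-- The product of two fractions. -/
def mul (x y : Frac) : Frac :=
  ((x.1.1 * y.1.1 + x.1.2 * y.1.2, x.1.1 * y.1.2 + x.1.2 * y.1.1), x.2 * y.2 + x.2 + y.2)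

/-- The difference of two fractions. -/
def sub (x y : Frac) : Frac :=
  ((x.1.1 * (y.2 + 1) + y.1.2 * (x.2 + 1), x.1.2 * (y.2 + 1) + y.1.1 * (x.2 + 1)),
    x.2 * y.2 + x.2 + y.2)

theorem val_mul (x y : Frac) : (mul x y).val = x.val * y.val := by
  simp only [val, mul]
  push_cast
  have h1 : (x.2 : ℝ) + 1 ≠ 0 := by positivity
  have h2 : (y.2 : ℝ) + 1 ≠ 0 := by positivity
  -- Only the predecessor of a denominator is stored, so multiplying denominators takes this form.
  have h3 : (x.2 : ℝ) * y.2 + x.2 + y.2 + 1 = (x.2 + 1) * (y.2 + 1) := by ring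
  rw [h3]
  field_simp
  ring

theorem val_sub (x y : Frac) : (sub x y).val = x.val - y.val := by
  simp only [val, sub]
  push_cast
  have h1 : (x.2 : ℝ) + 1 ≠ 0 := by positivity
  have h2 : (y.2 : ℝ) + 1 ≠ 0 := by positivity
  have h3 : (x.2 : ℝ) * y.2 + x.2 + y.2 + 1 = (x.2 + 1) * (y.2 + 1) := by ring
  rw [h3]
  field_simp
  ring

/-- The denominator is positive, so with the numerator kept as a difference of naturals the sign is
a comparison of naturals. -/
theorem val_pos_iff (x : Frac) : 0 < x.val ↔ x.1.2 < x.1.1 := by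
  have h1 : (0 : ℝ) < (x.2 : ℝ) + 1 := by positivity
  rw [val, div_pos_iff_of_pos_right h1, sub_pos, Nat.cast_lt]

theorem primrec_mul : Primrec₂ mul := by
  have a1 : Primrec fun p : Frac × Frac => p.1.1.1 :=
    Primrec.fst.comp (Primrec.fst.comp Primrec.fst)
  have a2 : Primrec fun p : Frac × Frac => p.1.1.2 :=
    Primrec.snd.comp (Primrec.fst.comp Primrec.fst)
  have b1 : Primrec fun p : Frac × Frac => p.2.1.1 :=
    Primrec.fst.comp (Primrec.fst.comp Primrec.snd)
  have b2 : Primrec fun p : Frac × Frac => p.2.1.2 :=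
    Primrec.snd.comp (Primrec.fst.comp Primrec.snd)
  have d1 : Primrec fun p : Frac × Frac => p.1.2 := Primrec.snd.comp Primrec.fst
  have d2 : Primrec fun p : Frac × Frac => p.2.2 := Primrec.snd.comp Primrec.snd
  exact Primrec.pair (Primrec.pair
    (Primrec.nat_add.comp (Primrec.nat_mul.comp a1 b1) (Primrec.nat_mul.comp a2 b2))
    (Primrec.nat_add.comp (Primrec.nat_mul.comp a1 b2) (Primrec.nat_mul.comp a2 b1)))
    (Primrec.nat_add.comp (Primrec.nat_add.comp (Primrec.nat_mul.comp d1 d2) d1) d2)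

theorem primrec_sub : Primrec₂ sub := by
  have a1 : Primrec fun p : Frac × Frac => p.1.1.1 :=
    Primrec.fst.comp (Primrec.fst.comp Primrec.fst)
  have a2 : Primrec fun p : Frac × Frac => p.1.1.2 :=
    Primrec.snd.comp (Primrec.fst.comp Primrec.fst)
  have b1 : Primrec fun p : Frac × Frac => p.2.1.1 :=
    Primrec.fst.comp (Primrec.fst.comp Primrec.snd)
  have b2 : Primrec fun p : Frac × Frac => p.2.1.2 :=
    Primrec.snd.comp (Primrec.fst.comp Primrec.snd)
  have d1 : Primrec fun p : Frac × Frac => p.1.2 := Primrec.snd.comp Primrec.fst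
  have d2 : Primrec fun p : Frac × Frac => p.2.2 := Primrec.snd.comp Primrec.snd
  have s1 := Primrec.succ.comp d1
  have s2 := Primrec.succ.comp d2
  exact Primrec.pair (Primrec.pair
    (Primrec.nat_add.comp (Primrec.nat_mul.comp a1 s2) (Primrec.nat_mul.comp b2 s1))
    (Primrec.nat_add.comp (Primrec.nat_mul.comp a2 s2) (Primrec.nat_mul.comp b1 s1)))
    (Primrec.nat_add.comp (Primrec.nat_add.comp (Primrec.nat_mul.comp d1 d2) d1) d2)

/-- The fraction with the given numerator and the given predecessor of the denominator. -/
def ofPair (x : ℤ × ℕ) : Frac := ((x.1.toNat, (-x.1).toNat), x.2)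

theorem val_ofPair (x : ℤ × ℕ) : (ofPair x).val = (x.1 : ℝ) / (x.2 + 1) := by
  have h : ((x.1.toNat : ℤ) : ℝ) - (((-x.1).toNat : ℤ) : ℝ) = (x.1 : ℝ) := by
    rw [← Int.cast_sub]
    congr 1
    omega
  simp only [val, ofPair]
  rw [← h]
  norm_cast

theorem primrec_ofPair : Primrec ofPair :=
  Primrec.pair (Primrec.pair (primrec_toNat.comp Primrec.fst)
    (primrec_neg_toNat.comp Primrec.fst)) Primrec.snd

end Frac

/-- The fractions whose signs are tested, for points with rational coordinates. -/
def ratTestValue (k : Fin 3) (U V W : RatPoint) : Frac :=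
  ![(Frac.ofPair V.1).sub (Frac.ofPair U.1), (Frac.ofPair V.2).sub (Frac.ofPair U.2),
    (((Frac.ofPair V.2).sub (Frac.ofPair U.2)).mul ((Frac.ofPair W.1).sub (Frac.ofPair U.1))).sub
    (((Frac.ofPair V.1).sub (Frac.ofPair U.1)).mul ((Frac.ofPair W.2).sub (Frac.ofPair U.2)))] k

theorem val_ratTestValue (k : Fin 3) (U V W : RatPoint) :
    (ratTestValue k U V W).val = testValue k U.toPlane V.toPlane W.toPlane := by
  fin_cases k <;> simp [ratTestValue, testValue, Frac.val_sub, Frac.val_mul, Frac.val_ofPair,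
    RatPoint.toPlane, area]

theorem primrec_ratTestValue {α : Type*} [Primcodable α] (k : Fin 3) {U V W : α → RatPoint}
    (hU : Primrec U) (hV : Primrec V) (hW : Primrec W) :
    Primrec fun x => ratTestValue k (U x) (V x) (W x) := by
  have c1 : ∀ {X : α → RatPoint}, Primrec X → Primrec fun x => Frac.ofPair (X x).1 :=
    fun h => Frac.primrec_ofPair.comp (Primrec.fst.comp h)
  have c2 : ∀ {X : α → RatPoint}, Primrec X → Primrec fun x => Frac.ofPair (X x).2 :=
    fun h => Frac.primrec_ofPair.comp (Primrec.snd.comp h)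
  fin_cases k
  · exact Frac.primrec_sub.comp (c1 hV) (c1 hU)
  · exact Frac.primrec_sub.comp (c2 hV) (c2 hU)
  · exact Frac.primrec_sub.comp
      (Frac.primrec_mul.comp (Frac.primrec_sub.comp (c2 hV) (c2 hU))
        (Frac.primrec_sub.comp (c1 hW) (c1 hU)))
      (Frac.primrec_mul.comp (Frac.primrec_sub.comp (c1 hV) (c1 hU))
        (Frac.primrec_sub.comp (c2 hW) (c2 hU)))

/-- The sign test for points with rational coordinates. -/
def ratTest (k : Fin 3) (U V W : RatPoint) : Bool :=
  decide ((ratTestValue k U V W).1.2 < (ratTestValue k U V W).1.1)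

theorem ratTest_eq_true (k : Fin 3) (U V W : RatPoint) :
    ratTest k U V W = true ↔ 0 < testValue k U.toPlane V.toPlane W.toPlane := by
  rw [ratTest, decide_eq_true_iff, ← val_ratTestValue, Frac.val_pos_iff]

theorem primrec_ratTest {α : Type*} [Primcodable α] (k : Fin 3) {U V W : α → RatPoint}
    (hU : Primrec U) (hV : Primrec V) (hW : Primrec W) :
    Primrec fun x => ratTest k (U x) (V x) (W x) := by
  have hv := primrec_ratTestValue k hU hV hW
  have h1 : Primrec fun x => (ratTestValue k (U x) (V x) (W x)).1.1 :=
    Primrec.fst.comp (Primrec.fst.comp hv)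
  have h2 : Primrec fun x => (ratTestValue k (U x) (V x) (W x)).1.2 :=
    Primrec.snd.comp (Primrec.fst.comp hv)
  exact (Primrec.nat_lt.comp h2 h1).decide

/-- The results of all sign tests for one edge, for points with rational coordinates. -/
noncomputable def ratAnswers {n : ℕ} (R : Fin (n + 2) → RatPoint) (j : Fin (testCount n)) : Bool :=
  ratTest (testEquiv n j).2.2.2 (R (testEquiv n j).1) (R (testEquiv n j).2.1)
    (R (testEquiv n j).2.2.1)

theorem ratAnswers_eq {n : ℕ} (P : Fin n → RatPoint) (A B : RatPoint) :
    ratAnswers (config P A B) =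
      answers (config (fun i => (P i).toPlane) A.toPlane B.toPlane) := by
  have hc : ∀ w, (config P A B w).toPlane =
      config (fun i => (P i).toPlane) A.toPlane B.toPlane w := by
    intro w
    refine Fin.cases rfl (fun w => Fin.cases rfl (fun w => rfl) w) w
  funext j
  rw [Bool.eq_iff_iff, ratAnswers, answers, ratTest_eq_true, decide_eq_true_iff]
  simp only [hc]

/-- The crossing word of a closed line with rational vertices. -/
noncomputable def ratLineLetters {n : ℕ} (P : Fin n → RatPoint) (l : List RatPoint) :
    List (Fin n × Bool) :=
  lineLetters (fun i j => ratAnswers (config P (l.getD i ((0, 0), (0, 0)))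
    (l.getD j ((0, 0), (0, 0))))) l.length

theorem primrec_ratLineLetters {n : ℕ} {α : Type*} [Primcodable α] {P : α → Fin n → RatPoint}
    {l : α → List RatPoint} (hP : Primrec P) (hl : Primrec l) :
    Primrec fun x => ratLineLetters (P x) (l x) := by
  have hlen : Primrec fun x => (l x).length := Primrec.list_length.comp hl
  refine primrec_lineLetters (g := fun x i j => ratAnswers (config (P x)
    ((l x).getD i ((0, 0), (0, 0))) ((l x).getD j ((0, 0), (0, 0))))) hlen fun t => ?_
  have hP' : Primrec fun p : α × ℕ × ℕ => P p.1 := hP.comp Primrec.fst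
  have hl' : Primrec fun p : α × ℕ × ℕ => l p.1 := hl.comp Primrec.fst
  have hi : Primrec fun p : α × ℕ × ℕ => (l p.1).getD p.2.1 ((0, 0), (0, 0)) :=
    (Primrec.list_getD _).comp hl' (Primrec.fst.comp Primrec.snd)
  have hj : Primrec fun p : α × ℕ × ℕ => (l p.1).getD p.2.2 ((0, 0), (0, 0)) :=
    (Primrec.list_getD _).comp hl' (Primrec.snd.comp Primrec.snd)
  have hc := primrec_config hP' hi hj
  exact primrec_ratTest (testEquiv n t).2.2.2 (hc (testEquiv n t).1) (hc (testEquiv n t).2.1)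
    (hc (testEquiv n t).2.2.1)

/-- The homotopy test for rational data. -/
noncomputable def ratDecide (n : ℕ)
    (x : (Fin n → RatPoint) × List RatPoint × List RatPoint) : Bool :=
  conjTest (ratLineLetters x.1 x.2.1) (ratLineLetters x.1 x.2.2)

theorem primrec_ratDecide (n : ℕ) : Primrec (ratDecide n) :=
  primrec_conjTest.comp
    (primrec_ratLineLetters Primrec.fst (Primrec.fst.comp Primrec.snd))
    (primrec_ratLineLetters Primrec.fst (Primrec.snd.comp Primrec.snd))

theorem decidesRationalHomotopy_ratDecide (n : ℕ) : DecidesRationalHomotopy n (ratDecide n) := by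
  refine ⟨(primrec_ratDecide n).to_comp, fun P l m hP hl hm => ?_⟩
  have main : ∀ l : List RatPoint,
      FreeGroup.mk (ratLineLetters P l) =
      cyclicWord (sortedEdgeWord fun i => (P i).toPlane) (l.map RatPoint.toPlane) := by
    intro l
    have := mk_lineLetters (P := fun i => (P i).toPlane) (l := l.map RatPoint.toPlane)
      (g := fun i j => ratAnswers (config P (l.getD i ((0, 0), (0, 0)))
        (l.getD j ((0, 0), (0, 0))))) (by
        intro i hi
        rw [List.length_map] at hi ⊢
        have hi' : (i + 1) % l.length < l.length := Nat.mod_lt _ (by omega)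
        -- All indices are in range, so the two different default values never meet.
        rw [ratAnswers_eq, List.getD_eq_getElem _ _ hi, List.getD_eq_getElem _ _ hi',
          List.getD_eq_getElem _ _ (by simpa using hi),
          List.getD_eq_getElem _ _ (by simpa using hi'), List.getElem_map, List.getElem_map])
    rw [List.length_map] at this
    exact this
  rw [ratDecide, conjTest_eq_true, homotopic_iff_isConj_sorted hP hl hm, main, main]

/-! ### Real data -/

/-- The polynomials whose signs are tested, for the points with the given numbers. -/
def testPoly (k : Fin 3) (u v w : ℕ) : IntPoly :=
  ![[(1, [2 * v]), (-1, [2 * u])], [(1, [2 * v + 1]), (-1, [2 * u + 1])],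
    [(-1, [2 * v, 2 * w + 1]), (1, [2 * v, 2 * u + 1]), (1, [2 * u, 2 * w + 1]),
      (1, [2 * v + 1, 2 * w]), (-1, [2 * v + 1, 2 * u]), (-1, [2 * u + 1, 2 * w])]] k

/-- No bound on `i` is needed: beyond the end both sides are `0`. -/
theorem coords_getD (l : List Plane) (i : ℕ) :
    (coords l).getD (2 * i) 0 = (l.getD i 0).1 ∧ (coords l).getD (2 * i + 1) 0 = (l.getD i 0).2 := by
  induction l generalizing i with
  | nil => simp [coords]
  | cons A t ih =>
    have hc : coords (A :: t) = A.1 :: A.2 :: coords t := rfl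
    rw [hc]
    cases i with
    | zero => simp
    | succ i =>
      have e : 2 * (i + 1) = 2 * i + 1 + 1 := by ring
      rw [e]
      simpa only [List.getD_cons_succ] using ih i

theorem eval_testPoly (l : List Plane) (k : Fin 3) (u v w : ℕ) :
    (testPoly k u v w).eval (coords l) =
      testValue k (l.getD u 0) (l.getD v 0) (l.getD w 0) := by
  have h1 := fun i => (coords_getD l i).1
  have h2 := fun i => (coords_getD l i).2
  fin_cases k
  · simp only [testPoly, IntPoly.eval, testValue, Fin.zero_eta, Matrix.cons_val_zero,
      List.map_cons, List.map_nil, List.prod_cons, List.prod_nil, List.sum_cons, List.sum_nil, h1]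
    push_cast
    ring
  · simp only [testPoly, IntPoly.eval, testValue, Fin.mk_one, Matrix.cons_val_one,
      Matrix.cons_val_zero,
      List.map_cons, List.map_nil, List.prod_cons, List.prod_nil, List.sum_cons, List.sum_nil, h2]
    push_cast
    ring
  · simp only [testPoly, IntPoly.eval, testValue, Fin.reduceFinMk, Matrix.cons_val, area,
      List.map_cons, List.map_nil, List.prod_cons, List.prod_nil, List.sum_cons, List.sum_nil,
      h1, h2]
    push_cast
    ring

theorem primrec_testPoly {α : Type*} [Primcodable α] (k : Fin 3) {u v w : α → ℕ}
    (hu : Primrec u) (hv : Primrec v) (hw : Primrec w) :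
    Primrec fun x => testPoly k (u x) (v x) (w x) := by
  have even : ∀ {f : α → ℕ}, Primrec f → Primrec fun x => 2 * f x :=
    fun h => Primrec.nat_mul.comp (Primrec.const 2) h
  have odd : ∀ {f : α → ℕ}, Primrec f → Primrec fun x => 2 * f x + 1 :=
    fun h => Primrec.succ.comp (Primrec.nat_mul.comp (Primrec.const 2) h)
  have one : ∀ {f : α → ℕ} (c : ℤ), Primrec f → Primrec fun x => (c, [f x]) :=
    fun c h => Primrec.pair (Primrec.const c) (Primrec.list_cons.comp h (Primrec.const []))
  have two : ∀ {f g : α → ℕ} (c : ℤ), Primrec f → Primrec g →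
      Primrec fun x => (c, [f x, g x]) := fun c h h' =>
    Primrec.pair (Primrec.const c)
      (Primrec.list_cons.comp h (Primrec.list_cons.comp h' (Primrec.const [])))
  have nil : Primrec fun _ : α => ([] : IntPoly) := Primrec.const []
  have cons : ∀ {f : α → ℤ × List ℕ} {g : α → IntPoly}, Primrec f → Primrec g →
      Primrec fun x => (f x :: g x : IntPoly) := fun h h' => Primrec.list_cons.comp h h'
  fin_cases k
  · exact cons (one 1 (even hv)) (cons (one (-1) (even hu)) nil)
  · exact cons (one 1 (odd hv)) (cons (one (-1) (odd hu)) nil)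
  · exact cons (two (-1) (even hv) (odd hw)) (cons (two 1 (even hv) (odd hu))
      (cons (two 1 (even hu) (odd hw)) (cons (two 1 (odd hv) (even hw))
      (cons (two (-1) (odd hv) (even hu)) (cons (two (-1) (odd hu) (even hw)) nil)))))

/-- The polynomials tested for the edge between the vertices with the numbers `u` and `v`, in the
sequence that starts with the `n` points. -/
noncomputable def edgePolys (n : ℕ) (u v : ℕ) : List IntPoly :=
  List.ofFn fun j : Fin (testCount n) =>
    testPoly (testEquiv n j).2.2.2 (config (fun i : Fin n => (i : ℕ)) u v (testEquiv n j).1)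
      (config (fun i : Fin n => (i : ℕ)) u v (testEquiv n j).2.1)
      (config (fun i : Fin n => (i : ℕ)) u v (testEquiv n j).2.2.1)

theorem primrec_edgePolys (n : ℕ) : Primrec₂ (edgePolys n) := by
  have hc := primrec_config (n := n) (α := ℕ × ℕ) (P := fun _ i => (i : ℕ))
    (Primrec.const _) Primrec.fst Primrec.snd
  exact Primrec.list_ofFn fun j => primrec_testPoly _ (hc _) (hc _) (hc _)

/-- The numbers of the initial and the final vertex of the edge number `e` of two closed lines with
`a` and `b` vertices. -/
def edgeEnds (n : ℕ) (s : ℕ × ℕ) (e : ℕ) : ℕ × ℕ :=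
  if e < s.1 then (n + e, n + (e + 1) % s.1)
  else (n + s.1 + (e - s.1), n + s.1 + (e - s.1 + 1) % s.2)

theorem primrec_edgeEnds (n : ℕ) : Primrec₂ (edgeEnds n) := by
  have a : Primrec fun p : (ℕ × ℕ) × ℕ => p.1.1 := Primrec.fst.comp Primrec.fst
  have b : Primrec fun p : (ℕ × ℕ) × ℕ => p.1.2 := Primrec.snd.comp Primrec.fst
  have e : Primrec fun p : (ℕ × ℕ) × ℕ => p.2 := Primrec.snd
  have hn : Primrec fun _ : (ℕ × ℕ) × ℕ => n := Primrec.const n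
  have na := Primrec.nat_add.comp hn a
  have d := Primrec.nat_sub.comp e a
  exact Primrec.ite (Primrec.nat_lt.comp e a)
    (Primrec.pair (Primrec.nat_add.comp hn e)
      (Primrec.nat_add.comp hn (Primrec.nat_mod.comp (Primrec.succ.comp e) a)))
    (Primrec.pair (Primrec.nat_add.comp na d)
      (Primrec.nat_add.comp na (Primrec.nat_mod.comp (Primrec.succ.comp d) b)))

/-- The polynomial of the query number `q`. -/
noncomputable def queryPoly (n : ℕ) (s : ℕ × ℕ) (q : ℕ) : IntPoly :=
  (edgePolys n (edgeEnds n s (q / testCount n)).1 (edgeEnds n s (q / testCount n)).2).getD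
    (q % testCount n) []

theorem primrec_queryPoly (n : ℕ) : Primrec₂ (queryPoly n) := by
  have q : Primrec fun p : (ℕ × ℕ) × ℕ => p.2 := Primrec.snd
  have k : Primrec fun _ : (ℕ × ℕ) × ℕ => testCount n := Primrec.const _
  have ends : Primrec fun p : (ℕ × ℕ) × ℕ => edgeEnds n p.1 (p.2 / testCount n) :=
    (primrec_edgeEnds n).comp Primrec.fst (Primrec.nat_div.comp q k)
  have polys : Primrec fun p : (ℕ × ℕ) × ℕ =>
      edgePolys n (edgeEnds n p.1 (p.2 / testCount n)).1 (edgeEnds n p.1 (p.2 / testCount n)).2 :=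
    (primrec_edgePolys n).comp (Primrec.fst.comp ends) (Primrec.snd.comp ends)
  exact (Primrec.list_getD _).comp polys (Primrec.nat_mod.comp q k)

/-- The crossing word of a closed line with `a` vertices, read off from the sequence `r` of the
results of the queries, where the queries for this line start with the edge number `s`. -/
noncomputable def historyLetters (n : ℕ) (r : List Bool) (s a : ℕ) : List (Fin n × Bool) :=
  lineLetters (fun i _ t => r.getD ((s + i) * testCount n + t) false) a

theorem primrec_historyLetters (n : ℕ) {α : Type*} [Primcodable α] {r : α → List Bool}
    {s a : α → ℕ} (hr : Primrec r) (hs : Primrec s) (ha : Primrec a) :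
    Primrec fun x => historyLetters n (r x) (s x) (a x) := by
  refine primrec_lineLetters
    (g := fun x i _ t => (r x).getD ((s x + i) * testCount n + t) false) ha fun t => ?_
  have hr' : Primrec fun p : α × ℕ × ℕ => r p.1 := hr.comp Primrec.fst
  have hs' : Primrec fun p : α × ℕ × ℕ => s p.1 := hs.comp Primrec.fst
  have hi : Primrec fun p : α × ℕ × ℕ => p.2.1 := Primrec.fst.comp Primrec.snd
  have hidx : Primrec fun p : α × ℕ × ℕ => (s p.1 + p.2.1) * testCount n + (t : ℕ) :=
    Primrec.nat_add.comp (Primrec.nat_mul.comp (Primrec.nat_add.comp hs' hi) (Primrec.const _))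
      (Primrec.const _)
  exact (Primrec.list_getD _).comp hr' hidx

/-- The control of the algorithm for real data: it asks for the signs of all test polynomials for
all edges, and then compares the crossing words. -/
noncomputable def realControl (n : ℕ) (x : (ℕ × ℕ) × List Bool) : IntPoly ⊕ Bool :=
  if x.2.length < (x.1.1 + x.1.2) * testCount n then Sum.inl (queryPoly n x.1 x.2.length)
  else Sum.inr (conjTest (historyLetters n x.2.reverse 0 x.1.1)
    (historyLetters n x.2.reverse x.1.1 x.1.2))

theorem primrec_realControl (n : ℕ) : Primrec (realControl n) := by
  have a : Primrec fun x : (ℕ × ℕ) × List Bool => x.1.1 := Primrec.fst.comp Primrec.fst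
  have b : Primrec fun x : (ℕ × ℕ) × List Bool => x.1.2 := Primrec.snd.comp Primrec.fst
  have len : Primrec fun x : (ℕ × ℕ) × List Bool => x.2.length :=
    Primrec.list_length.comp Primrec.snd
  have rev : Primrec fun x : (ℕ × ℕ) × List Bool => x.2.reverse :=
    Primrec.list_reverse.comp Primrec.snd
  refine Primrec.ite (Primrec.nat_lt.comp len
    (Primrec.nat_mul.comp (Primrec.nat_add.comp a b) (Primrec.const _))) ?_ ?_
  · exact Primrec.sumInl.comp ((primrec_queryPoly n).comp Primrec.fst len)
  · exact Primrec.sumInr.comp (primrec_conjTest.comp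
      (primrec_historyLetters n rev (Primrec.const 0) a) (primrec_historyLetters n rev a b))

open Classical in
/-- A control that asks a fixed number of queries, independent of the answers, and stops. -/
theorem haltsWith_of_nonadaptive {S : List Bool → IntPoly ⊕ Bool} {x : List ℝ} {N : ℕ}
    {Q : ℕ → IntPoly} {F : List Bool → Bool}
    (hS : ∀ h, S h = if h.length < N then Sum.inl (Q h.length) else Sum.inr (F h)) :
    HaltsWith S x (F ((List.range N).map fun q => decide (0 < (Q q).eval x)).reverse) := by
  -- Histories list the latest answer first, hence the reversal.
  have reach : ∀ k ≤ N, ReachesHistory S x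
      ((List.range k).map fun q => decide (0 < (Q q).eval x)).reverse := by
    intro k
    induction k with
    | zero => exact fun _ => ReachesHistory.start
    | succ k ih =>
      intro hk
      have hq : S ((List.range k).map fun q => decide (0 < (Q q).eval x)).reverse =
          Sum.inl (Q k) := by
        rw [hS]
        simp only [List.length_reverse, List.length_map, List.length_range]
        rw [if_pos (by omega)]
      rw [List.range_succ, List.map_append, List.reverse_append]
      by_cases hpos : 0 < (Q k).eval x
      · simpa [hpos] using (ih (by omega)).yes hq hpos
      · simpa [hpos] using (ih (by omega)).no hq hpos
  refine ⟨_, reach N le_rfl, ?_⟩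
  rw [hS, if_neg (by simp)]

/-- In the combined sequence the points come first, so vertex numbers are shifted by `n`. -/
theorem getD_config {n : ℕ} (P : Fin n → Plane) (k : List Plane) (u v : ℕ) (w : Fin (n + 2)) :
    (List.ofFn P ++ k).getD (config (fun i : Fin n => (i : ℕ)) (n + u) (n + v) w) 0 =
      config P (k.getD u 0) (k.getD v 0) w := by
  have aux : ∀ u, (List.ofFn P ++ k).getD (n + u) 0 = k.getD u 0 := by
    intro u
    rw [List.getD_append_right _ _ _ _ (by simp)]
    simp
  refine Fin.cases (aux u) (fun w => Fin.cases (aux v) (fun w => ?_) w) w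
  change (List.ofFn P ++ k).getD (w : ℕ) 0 = P w
  rw [List.getD_append _ _ _ _ (by simp), List.getD_eq_getElem _ _ (by simp)]
  simp

-- Queries are numbered edge by edge: division by `testCount n` recovers the edge, the remainder the
-- test.
open Classical in
theorem decide_queryPoly {n : ℕ} (P : Fin n → Plane) (k : List Plane) (s : ℕ × ℕ) (e u v : ℕ)
    (he : edgeEnds n s e = (n + u, n + v)) (t : Fin (testCount n)) :
    decide (0 < (queryPoly n s (e * testCount n + t)).eval (coords (List.ofFn P ++ k))) =
      answers (config P (k.getD u 0) (k.getD v 0)) t := by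
  have hpos : 0 < testCount n := lt_of_le_of_lt (Nat.zero_le _) t.2
  have hdiv : (e * testCount n + t) / testCount n = e := by
    rw [mul_comm, Nat.mul_add_div hpos, Nat.div_eq_of_lt t.2, add_zero]
  have hmod : (e * testCount n + t) % testCount n = t := by
    rw [mul_comm, Nat.mul_add_mod, Nat.mod_eq_of_lt t.2]
  rw [queryPoly, hdiv, hmod, he, edgePolys, List.getD_eq_getElem _ _ (by simp),
    List.getElem_ofFn]
  simp only [eval_testPoly, getD_config]
  rfl

theorem decidesRealHomotopy_realControl (n : ℕ) : DecidesRealHomotopy n (realControl n) := by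
  classical
  refine ⟨(primrec_realControl n).to_comp, fun P l m hP hl hm => ?_⟩
  refine ⟨_, haltsWith_of_nonadaptive (S := fun h => realControl n ((l.length, m.length), h))
    (N := (l.length + m.length) * testCount n) (Q := queryPoly n (l.length, m.length))
    (F := fun h => conjTest (historyLetters n h.reverse 0 l.length)
      (historyLetters n h.reverse l.length m.length)) (fun h => rfl), ?_⟩
  rw [conjTest_eq_true, homotopic_iff_isConj_sorted hP hl hm, List.reverse_reverse,
    List.append_assoc]
  have get : ∀ e, e < l.length + m.length → ∀ t : Fin (testCount n),
      ((List.range ((l.length + m.length) * testCount n)).map fun q =>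
        decide (0 < (queryPoly n (l.length, m.length) q).eval
          (coords (List.ofFn P ++ (l ++ m))))).getD (e * testCount n + t) false =
      decide (0 < (queryPoly n (l.length, m.length) (e * testCount n + t)).eval
          (coords (List.ofFn P ++ (l ++ m)))) := by
    intro e he t
    have hlt : e * testCount n + t < (l.length + m.length) * testCount n := by
      calc e * testCount n + t < e * testCount n + testCount n := by have := t.2; omega
        _ = (e + 1) * testCount n := by ring
        _ ≤ _ := Nat.mul_le_mul_right _ he
    rw [List.getD_eq_getElem _ _ (by simpa using hlt)]
    simp
  have wl : FreeGroup.mk (historyLetters n ((List.range ((l.length + m.length) * testCount n)).map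
      fun q => decide (0 < (queryPoly n (l.length, m.length) q).eval
        (coords (List.ofFn P ++ (l ++ m))))) 0 l.length) =
      cyclicWord (sortedEdgeWord P) l := by
    refine mk_lineLetters fun i hi => funext fun t => ?_
    have hi' : (i + 1) % l.length < l.length := Nat.mod_lt _ (by omega)
    rw [zero_add, get i (by omega) t,
      decide_queryPoly P (l ++ m) _ i i ((i + 1) % l.length) (by simp [edgeEnds, hi]),
      List.getD_append _ _ _ _ hi, List.getD_append _ _ _ _ hi']
  -- For the second line both the edge numbers and the positions of vertices in `l ++ m` are shifted
  -- by `l.length`.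
  have wm : FreeGroup.mk (historyLetters n ((List.range ((l.length + m.length) * testCount n)).map
      fun q => decide (0 < (queryPoly n (l.length, m.length) q).eval
        (coords (List.ofFn P ++ (l ++ m))))) l.length m.length) =
      cyclicWord (sortedEdgeWord P) m := by
    refine mk_lineLetters fun i hi => funext fun t => ?_
    rw [get (l.length + i) (by omega) t,
      decide_queryPoly P (l ++ m) _ (l.length + i) (l.length + i)
        (l.length + (i + 1) % m.length) (by simp [edgeEnds, add_assoc]),
      List.getD_append_right _ _ _ _ (by omega), List.getD_append_right _ _ _ _ (by omega),
      Nat.add_sub_cancel_left, Nat.add_sub_cancel_left]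
  rw [← wl, ← wm]

/-- For every `n` there is an algorithm recognizing homotopy of closed polygonal lines in the plane
minus `n` points: a Turing-machine algorithm for rational data, and an algorithm with exact real
arithmetic for arbitrary real data. -/
theorem theorem1p7 (n : ℕ) :
    (∃ D : (Fin n → RatPoint) × List RatPoint × List RatPoint → Bool,
      DecidesRationalHomotopy n D) ∧
    (∃ S : (ℕ × ℕ) × List Bool → IntPoly ⊕ Bool, DecidesRealHomotopy n S) :=
  ⟨⟨_, decidesRationalHomotopy_ratDecide n⟩, ⟨_, decidesRealHomotopy_realControl n⟩⟩
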